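/- Let $k$ be a positive integer with $k\equiv 7 \pmod{15}$, and put \[ n=\frac{512k^5+1280k^4+6080k^3+7840k^2+10010k+3741}{3125}, \] \[ g_1=1,\qquad g_2=\frac{128k^4+256k^3+1192k^2+1064k+883}{625}, \] \[ g_3=\frac{512k^5+640k^4+3200k^3-2520k^2-8510k-12624}{9375}, \] \[ g_4=\frac{512k^5+640k^4+5600k^3+1080k^2+4540k-6699}{9375}, \] \[ g_5=\frac{512k^5+640k^4+5600k^3+1080k^2+12040k-2949}{9375}. \] Then $n,g_1,\dots,g_5$ are positive integers, the $g_i$ are pairwise distinct and satisfy $0<g_i<n/2$, and the undirected circulant graph of order $n$ with generating set $\{g_1,\dots,g_5\}$ (the vertices are the elements of $\mathbb{Z}_n$, and two vertices are adjacent if and only if their difference is $\pm g_i$ for some $i$) is connected, is regular of degree $10$, and has diameter exactly $k$. -/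

import Mathlib

/-- `IsCanonicalGeneratingSet n g`: the five integers `g 0, …, g 4` are pairwise distinct and lie
strictly between `0` and `n / 2`. Hence their residues and the negatives of these are ten different
nonzero elements of `ZMod n`, the connection set of a circulant graph of order `n`. -/
def IsCanonicalGeneratingSet (n : ℕ) (g : Fin 5 → ℕ) : Prop :=
  Function.Injective g ∧ ∀ i, 0 < g i ∧ 2 * g i < n

/-- The undirected circulant graph on `ZMod n` with generators `g 0, …, g 4`: two vertices are
adjacent when they are distinct and differ by the residue of some `g i` or its negative. -/
def circulantOn (n : ℕ) (g : Fin 5 → ℕ) : SimpleGraph (ZMod n) :=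
  SimpleGraph.circulantGraph (Set.range fun i => (g i : ZMod n))

/-! The distance between two vertices is the least `ℓ¹` norm of an integer vector whose `weight` is
the difference of the vertices modulo `n`. So the diameter is the `ℓ¹` covering radius of the
lattice `L` of vectors of weight zero. Put `k = 15m + 7`, `t = 2m + 1`, `p = 3t`, so that `2k + 1 =
5p`. Then `L` consists of the integral half-sums of the rows of `M = 2p • 1 + N`, with `N`
antisymmetric and entries in `{0, ±1}`; integrality means that all five coefficients have the same
parity.

Upper bound: it suffices to shorten each `x` of norm `k + 1` modulo `L` (`not_farFromLattice`),
since stepping along the generator 1 raises the norm by at most one. Take signs `s` agreeing with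
`x` and `y = sM/2` in `L`. If `y` dominates `x` in every coordinate, the norm of `x - y` is `5p - (k
+ 1) = k`, because `N` cancels in `s · y`. Domination is automatic at small coordinates. At a large
one, either a row of `M` already shortens `x`, or the failure to do so is the required inequality.
At most two coordinates are large, except in a finite case with `p = 3`.

Lower bound: a point with coordinates `(p ± 1)/2` and norm `k` lies at distance at least `k` from
all of `L` (`lt_norm_of_eq`): far coefficients are excluded by size, the others one by one. -/

/-! ### Choosing signs compatible with an unshortenable vector -/

theorem exists_sign_abs (x : ℤ) : ∃ s : ℤ, (s = 1 ∨ s = -1) ∧ |x| = s * x := by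
  rcases le_total 0 x with h | h
  · exact ⟨1, Or.inl rfl, by rw [abs_of_nonneg h, one_mul]⟩
  · exact ⟨-1, Or.inr rfl, by rw [abs_of_nonpos h]; ring⟩

/-- At `x = 0` either sign is admissible, and the one opposite to `α` makes the identity hold;
elsewhere the sign is forced. -/
theorem exists_sign_abs_sub (x α : ℤ) (hα : |α| ≤ 1) :
    ∃ s : ℤ, (s = 1 ∨ s = -1) ∧ 0 ≤ s * x ∧ |x - α| = |x| - s * α := by
  obtain ⟨h₁, h₂⟩ := abs_le.1 hα
  rcases lt_trichotomy x 0 with h | rfl | h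
  · exact ⟨-1, Or.inr rfl, by omega, by rw [abs_of_neg h, abs_of_nonpos (by omega)]; ring⟩
  · rcases le_total 0 α with h | h
    · exact ⟨-1, Or.inr rfl, by omega, by rw [abs_of_nonpos (by omega)]; simp⟩
    · exact ⟨1, Or.inl rfl, by omega, by rw [abs_of_nonneg (by omega)]; simp⟩
  · exact ⟨1, Or.inl rfl, by omega, by rw [abs_of_pos h, abs_of_nonneg (by omega)]; ring⟩

theorem abs_sub_of_abs_eq {x s e : ℤ} (hs : s = 1 ∨ s = -1) (h : |x| = s * x)
    (he : s * e ≤ |x|) : |x - e| = |x| - s * e := by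
  rcases hs with rfl | rfl
  · rw [h, abs_of_nonneg (by omega)]; ring
  · rw [h, abs_of_nonpos (by omega)]; ring

theorem abs_sub_of_le_abs {x s e : ℤ} (hs : s = 1 ∨ s = -1) (h : |x| = s * x)
    (he : |x| ≤ s * e) : |x - e| = s * e - |x| := by
  rcases hs with rfl | rfl
  · rw [h, abs_of_nonpos (by omega)]; ring
  · rw [h, abs_of_nonneg (by omega)]; ring

theorem abs_sign_mul {s : ℤ} (hs : s = 1 ∨ s = -1) (x : ℤ) : |s * x| = |x| := by
  rcases hs with rfl | rfl <;> simp

theorem abs_sub_le_abs_add_one {x α : ℤ} (hα : |α| ≤ 1) : |x - α| ≤ |x| + 1 := by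
  have := abs_sub x α; omega

/-- A coordinate that cannot be shortened by subtracting one of the long vectors is small. -/
theorem abs_le_of_forall_le {p X Y S U W κ α β γ : ℤ} (hp : 3 ≤ p)
    (hκ : |κ| ≤ 1) (hα : |α| ≤ 1) (hβ : |β| ≤ 1) (hγ : |γ| ≤ 1)
    (hX : ∀ σ : ℤ, |X| + |Y| + |S| + |U| + |W| ≤
      |X - 2 * p * σ| + |Y - σ * κ| + |S - σ * α| + |U - σ * β| + |W - σ * γ|) :
    |X| ≤ p + 2 := by
  obtain ⟨σ, hσ, hσX⟩ := exists_sign_abs X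
  have h₁ := abs_sub_le_abs_add_one (x := Y) ((abs_sign_mul hσ κ).trans_le hκ)
  have h₂ := abs_sub_le_abs_add_one (x := S) ((abs_sign_mul hσ α).trans_le hα)
  have h₃ := abs_sub_le_abs_add_one (x := U) ((abs_sign_mul hσ β).trans_le hβ)
  have h₄ := abs_sub_le_abs_add_one (x := W) ((abs_sign_mul hσ γ).trans_le hγ)
  have h := hX σ
  have hσσ : σ * (2 * p * σ) = 2 * p := by rcases hσ with rfl | rfl <;> ring
  rcases le_total |X| (2 * p) with hle | hle
  · rw [abs_sub_of_le_abs hσ hσX (by omega)] at h; omega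
  · rw [abs_sub_of_abs_eq hσ hσX (by omega)] at h; omega

/-- Subtracting the row with the sign of `X` does not shorten the vector. Once the signs at zero
coordinates are chosen well, this is literally the domination inequality for `X`. The crude bound `p
+ 2` keeps `X` short of `2p`. -/
theorem exists_signs_of_one_large {p X Y S U W κ α β γ : ℤ} (hp : 3 ≤ p)
    (hκ : |κ| ≤ 1) (hα : |α| ≤ 1) (hβ : |β| ≤ 1) (hγ : |γ| ≤ 1)
    (hX : ∀ σ : ℤ, |X| + |Y| + |S| + |U| + |W| ≤
      |X - 2 * p * σ| + |Y - σ * κ| + |S - σ * α| + |U - σ * β| + |W - σ * γ|) :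
    ∃ σ τ s u w : ℤ, ((σ = 1 ∨ σ = -1) ∧ (τ = 1 ∨ τ = -1) ∧ (s = 1 ∨ s = -1) ∧
      (u = 1 ∨ u = -1) ∧ (w = 1 ∨ w = -1)) ∧
      (0 ≤ σ * X ∧ 0 ≤ τ * Y ∧ 0 ≤ s * S ∧ 0 ≤ u * U ∧ 0 ≤ w * W) ∧
      2 * (σ * X) ≤ 2 * p - σ * (τ * κ + s * α + u * β + w * γ) := by
  have hle := abs_le_of_forall_le hp hκ hα hβ hγ hX
  obtain ⟨σ, hσ, hσX⟩ := exists_sign_abs X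
  obtain ⟨τ, hτ, hτY, h₁⟩ := exists_sign_abs_sub Y _ ((abs_sign_mul hσ κ).trans_le hκ)
  obtain ⟨s, hs, hsS, h₂⟩ := exists_sign_abs_sub S _ ((abs_sign_mul hσ α).trans_le hα)
  obtain ⟨u, hu, huU, h₃⟩ := exists_sign_abs_sub U _ ((abs_sign_mul hσ β).trans_le hβ)
  obtain ⟨w, hw, hwW, h₄⟩ := exists_sign_abs_sub W _ ((abs_sign_mul hσ γ).trans_le hγ)
  refine ⟨σ, τ, s, u, w, ⟨hσ, hτ, hs, hu, hw⟩, ⟨hσX ▸ abs_nonneg X, hτY, hsS, huU, hwW⟩, ?_⟩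
  have hσσ : σ * (2 * p * σ) = 2 * p := by rcases hσ with rfl | rfl <;> ring
  have h := hX σ
  rw [h₁, h₂, h₃, h₄, abs_sub_of_le_abs hσ hσX (by omega), hσσ] at h
  rw [← hσX]
  linarith

/-- The two-coordinate case in normalized form: `y`, `z` are absolute values of the large
coordinates, and `S` is the only coordinate both perturbations touch. -/
theorem exists_signs_normalized {p y z S U W κ α β αU βU αW βW : ℤ}
    (hα : α = 1 ∨ α = -1) (hβ : β = 1 ∨ β = -1)
    (hpar : 2 ∣ κ + β + βU + βW)
    (hU : |αU| ≤ 1 ∧ βU = 0 ∨ αU = 0 ∧ |βU| ≤ 1) (hW : |αW| ≤ 1 ∧ βW = 0 ∨ αW = 0 ∧ |βW| ≤ 1)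
    (hy : y + z + |S| + |U| + |W| ≤ (2 * p - y) + (z - κ) + |S - α| + |U - αU| + |W - αW|)
    (hz : y + z + |S| + |U| + |W| ≤ (y + κ) + (2 * p - z) + |S - β| + |U - βU| + |W - βW|)
    (hyz : y + z + |S| + |U| + |W| ≤ (2 * p - y + κ) + (2 * p - z - κ) + |S - (α + β)|
      + |U - (αU + βU)| + |W - (αW + βW)|) :
    ∃ s u w : ℤ, ((s = 1 ∨ s = -1) ∧ (u = 1 ∨ u = -1) ∧ (w = 1 ∨ w = -1)) ∧
      (0 ≤ s * S ∧ 0 ≤ u * U ∧ 0 ≤ w * W) ∧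
      2 * y ≤ 2 * p - (κ + s * α + u * αU + w * αW) ∧
      2 * z ≤ 2 * p - (-κ + s * β + u * βU + w * βW) := by
  have key : ∀ {x a b : ℤ}, |a| ≤ 1 ∧ b = 0 ∨ a = 0 ∧ |b| ≤ 1 →
      ∃ s : ℤ, (s = 1 ∨ s = -1) ∧ 0 ≤ s * x ∧ |x - a| = |x| - s * a ∧ |x - b| = |x| - s * b ∧
        |x - (a + b)| = |x| - s * a - s * b := by
    rintro x a b (⟨h, rfl⟩ | ⟨rfl, h⟩) <;> obtain ⟨s, hs, h₀, h₁⟩ := exists_sign_abs_sub x _ h <;>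
      exact ⟨s, hs, h₀, by simp [h₁]⟩
  obtain ⟨u, hu, huU, hu₁, hu₂, hu₃⟩ := key (x := U) hU
  obtain ⟨w, hw, hwW, hw₁, hw₂, hw₃⟩ := key (x := W) hW
  rw [hu₁, hw₁] at hy
  rw [hu₂, hw₂] at hz
  rw [hu₃, hw₃] at hyz
  -- The two perturbations ask for opposite signs only at a zero shared coordinate.
  by_cases hc : S = 0 ∧ α = -β
  · obtain ⟨rfl, rfl⟩ := hc
    have hβ1 : |(0 : ℤ) - -β| = 1 ∧ |(0 : ℤ) - β| = 1 := by rcases hβ with rfl | rfl <;> simp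
    rw [hβ1.1] at hy
    rw [hβ1.2] at hz
    simp only [abs_zero, neg_add_cancel, sub_zero] at hy hz hyz
    by_cases hz' : 2 * z ≤ 2 * p - (-κ + 1 + u * βU + w * βW)
    · exact ⟨β, u, w, ⟨hβ, hu, hw⟩, ⟨by simp, huU, hwW⟩,
        by rcases hβ with rfl | rfl <;> linarith, by rcases hβ with rfl | rfl <;> linarith⟩
    · have : 2 * y ≤ 2 * p - (κ + 1 + u * αU + w * αW) := by
        -- By `hpar` the right side of the failed inequality is even, so it fails by at least 2. The
        -- slack then passes to `y` through `hyz`.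
        have : 2 * p - (-κ + u * βU + w * βW) + 1 ≤ 2 * z := by
          rcases hu with rfl | rfl <;> rcases hw with rfl | rfl <;> omega
        linarith
      refine ⟨-β, u, w, ⟨by omega, hu, hw⟩, ⟨by simp, huU, hwW⟩, ?_, ?_⟩ <;>
        rcases hβ with rfl | rfl <;> linarith
  · obtain ⟨s, hs, hsS, h₁, h₂⟩ : ∃ s : ℤ, (s = 1 ∨ s = -1) ∧ 0 ≤ s * S ∧
        |S - α| = |S| - s * α ∧ |S - β| = |S| - s * β := by
      obtain ⟨s, hs, hsS, h₁⟩ := exists_sign_abs_sub S α (by rcases hα with rfl | rfl <;> simp)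
      refine ⟨s, hs, hsS, h₁, ?_⟩
      rcases eq_or_ne S 0 with rfl | hS
      · have : α = β := by omega
        rwa [← this]
      · have : |S| = s * S := by rw [← abs_sign_mul hs, abs_of_nonneg hsS]
        have : 1 ≤ |S| := Int.one_le_abs hS
        refine abs_sub_of_abs_eq hs ‹_› (le_trans ?_ this)
        rcases hs with rfl | rfl <;> omega
    rw [h₁] at hy
    rw [h₂] at hz
    exact ⟨s, u, w, ⟨hs, hu, hw⟩, ⟨hsS, huU, hwW⟩, by linarith, by linarith⟩

/-- Multiplying by the signs of `X` and `Y` reduces to `exists_signs_normalized`. Besides the two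
rows, their signed sum is needed, to settle a conflict at `S`. The parity hypothesis says that the
row of `Y` has an even number of odd entries. -/
theorem exists_signs_of_two_large {p X Y S U W κ α β αU βU αW βW : ℤ} (hp : 3 ≤ p)
    (hX₀ : X ≠ 0) (hY₀ : Y ≠ 0) (hκ : |κ| ≤ 1) (hα : α = 1 ∨ α = -1) (hβ : β = 1 ∨ β = -1)
    (hpar : 2 ∣ κ + β + βU + βW)
    (hU : |αU| ≤ 1 ∧ βU = 0 ∨ αU = 0 ∧ |βU| ≤ 1) (hW : |αW| ≤ 1 ∧ βW = 0 ∨ αW = 0 ∧ |βW| ≤ 1)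
    (hX : ∀ σ : ℤ, |X| + |Y| + |S| + |U| + |W| ≤
      |X - 2 * p * σ| + |Y - σ * κ| + |S - σ * α| + |U - σ * αU| + |W - σ * αW|)
    (hY : ∀ τ : ℤ, |X| + |Y| + |S| + |U| + |W| ≤
      |X + τ * κ| + |Y - 2 * p * τ| + |S - τ * β| + |U - τ * βU| + |W - τ * βW|)
    (hXY : ∀ σ τ : ℤ, |X| + |Y| + |S| + |U| + |W| ≤
      |X - (2 * p * σ - τ * κ)| + |Y - (2 * p * τ + σ * κ)| + |S - (σ * α + τ * β)|
        + |U - (σ * αU + τ * βU)| + |W - (σ * αW + τ * βW)|) :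
    ∃ σ τ s u w : ℤ, ((σ = 1 ∨ σ = -1) ∧ (τ = 1 ∨ τ = -1) ∧ (s = 1 ∨ s = -1) ∧
      (u = 1 ∨ u = -1) ∧ (w = 1 ∨ w = -1)) ∧
      (0 ≤ σ * X ∧ 0 ≤ τ * Y ∧ 0 ≤ s * S ∧ 0 ≤ u * U ∧ 0 ≤ w * W) ∧
      2 * (σ * X) ≤ 2 * p - σ * (τ * κ + s * α + u * αU + w * αW) ∧
      2 * (τ * Y) ≤ 2 * p - τ * (-σ * κ + s * β + u * βU + w * βW) := by
  have hα₁ : |α| ≤ 1 := by rcases hα with rfl | rfl <;> simp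
  have hβ₁ : |β| ≤ 1 := by rcases hβ with rfl | rfl <;> simp
  have hb : ∀ {a b : ℤ}, |a| ≤ 1 ∧ b = 0 ∨ a = 0 ∧ |b| ≤ 1 → |a| ≤ 1 ∧ |b| ≤ 1 := by
    rintro a b (⟨h, rfl⟩ | ⟨rfl, h⟩) <;> simp [h]
  have hXle := abs_le_of_forall_le hp hκ hα₁ (hb hU).1 (hb hW).1 hX
  have hYle := abs_le_of_forall_le (X := Y) (Y := X) (κ := -κ) hp (by rwa [abs_neg]) hβ₁ (hb hU).2
    (hb hW).2 fun τ => by have := hY τ; rw [mul_neg, sub_neg_eq_add]; linarith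
  obtain ⟨σ, hσ, hσX⟩ := exists_sign_abs X
  obtain ⟨τ, hτ, hτY⟩ := exists_sign_abs Y
  have hX₁ := Int.one_le_abs hX₀
  have hY₁ := Int.one_le_abs hY₀
  have hσσ : σ * σ = 1 := by rcases hσ with rfl | rfl <;> rfl
  have hττ : τ * τ = 1 := by rcases hτ with rfl | rfl <;> rfl
  have hστκ := abs_le.1 (((abs_sign_mul hσ _).trans (abs_sign_mul hτ κ)).trans_le hκ)
  have e₁ : |X - 2 * p * σ| = 2 * p - |X| := by
    have : σ * (2 * p * σ) = 2 * p := by linear_combination 2 * p * hσσ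
    rw [abs_sub_of_le_abs hσ hσX (by omega), this]
  have e₂ : |Y - σ * κ| = |Y| - σ * (τ * κ) := by
    have : τ * (σ * κ) = σ * (τ * κ) := by ring
    rw [abs_sub_of_abs_eq hτ hτY (by omega), this]
  have e₃ : |Y - 2 * p * τ| = 2 * p - |Y| := by
    have : τ * (2 * p * τ) = 2 * p := by linear_combination 2 * p * hττ
    rw [abs_sub_of_le_abs hτ hτY (by omega), this]
  have e₄ : |X + τ * κ| = |X| + σ * (τ * κ) := by
    have : σ * (-(τ * κ)) = -(σ * (τ * κ)) := by ring
    rw [← sub_neg_eq_add, abs_sub_of_abs_eq hσ hσX (by omega), this, sub_neg_eq_add]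
  have e₅ : |X - (2 * p * σ - τ * κ)| = 2 * p - |X| - σ * (τ * κ) := by
    have : σ * (2 * p * σ - τ * κ) = 2 * p - σ * (τ * κ) := by linear_combination 2 * p * hσσ
    rw [abs_sub_of_le_abs hσ hσX (by omega), this]; ring
  have e₆ : |Y - (2 * p * τ + σ * κ)| = 2 * p - |Y| + σ * (τ * κ) := by
    have : τ * (2 * p * τ + σ * κ) = 2 * p + σ * (τ * κ) := by linear_combination 2 * p * hττ
    rw [abs_sub_of_le_abs hτ hτY (by omega), this]; ring
  have hmul : ∀ {a b : ℤ}, |a| ≤ 1 ∧ b = 0 ∨ a = 0 ∧ |b| ≤ 1 →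
      |σ * a| ≤ 1 ∧ τ * b = 0 ∨ σ * a = 0 ∧ |τ * b| ≤ 1 := by
    rintro a b (⟨h, rfl⟩ | ⟨rfl, h⟩)
    · exact Or.inl ⟨(abs_sign_mul hσ _).trans_le h, mul_zero _⟩
    · exact Or.inr ⟨mul_zero _, (abs_sign_mul hτ _).trans_le h⟩
  have h₁ := hX σ
  have h₂ := hY τ
  have h₃ := hXY σ τ
  rw [e₁, e₂] at h₁
  rw [e₃, e₄] at h₂
  rw [e₅, e₆] at h₃
  obtain ⟨s, u, w, ⟨hs, hu, hw⟩, ⟨hsS, huU, hwW⟩, hy, hz⟩ :=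
    exists_signs_normalized (p := p) (y := |X|) (z := |Y|) (S := S) (U := U) (W := W)
      (κ := σ * (τ * κ)) (α := σ * α) (β := τ * β)
      (by rcases hσ with rfl | rfl <;> omega) (by rcases hτ with rfl | rfl <;> omega)
      (by rcases hσ with rfl | rfl <;> rcases hτ with rfl | rfl <;> omega)
      (hmul hU) (hmul hW) h₁ h₂ (by linarith)
  refine ⟨σ, τ, s, u, w, ⟨hσ, hτ, hs, hu, hw⟩,
    ⟨hσX ▸ abs_nonneg X, hτY ▸ abs_nonneg Y, hsS, huU, hwW⟩, ?_, ?_⟩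
  · rw [← hσX]; linarith
  · rw [← hτY]; linarith

/-! ### Half-sums of the rows with signs -/

/-- Twice the `ℓ¹` distance from `(a, b, c, d, e)` to the half-integral combination, with
coefficients `A / 2, …, E / 2`, of the rows of `2p • 1` plus an antisymmetric matrix. -/
def twiceDist (p a b c d e A B C D E : ℤ) : ℤ :=
  |2 * a - (2 * p * A - D + E)| + |2 * b - (2 * p * B + C - D)| + |2 * c - (2 * p * C - B - D)|
    + |2 * d - (2 * p * D + A + B + C + E)| + |2 * e - (2 * p * E - A - D)|

/-- Every vector of the lattice is at `ℓ¹` distance greater than `k`. -/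
def FarFromLattice (p k a b c d e : ℤ) : Prop :=
  ∀ A B C D E : ℤ, 2 ∣ A - B → 2 ∣ A - C → 2 ∣ A - D → 2 ∣ A - E →
    2 * k + 2 ≤ twiceDist p a b c d e A B C D E

/-- Domination for a small coordinate, whatever the signs. It is used with `w = 1` for the rows with
two off-diagonal entries and `w = 2` for the fourth row, which has four. -/
theorem small_row {p w x s t r u v κ α β γ : ℤ} (hs : s = 1 ∨ s = -1) (ht : t = 1 ∨ t = -1)
    (hr : r = 1 ∨ r = -1) (hu : u = 1 ∨ u = -1) (hv : v = 1 ∨ v = -1) (hx : |x| ≤ p - w)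
    (hw : |κ| + |α| + |β| + |γ| ≤ 2 * w) :
    2 * (s * x) ≤ 2 * p - s * (t * κ + r * α + u * β + v * γ) := by
  have h₁ := (le_abs_self (s * x)).trans_eq (abs_sign_mul hs x)
  have h₂ := (le_abs_self _).trans_eq (abs_sign_mul hs (t * κ + r * α + u * β + v * γ))
  have h₃ := abs_add_le (t * κ + r * α + u * β) (v * γ)
  have h₄ := abs_add_le (t * κ + r * α) (u * β)
  have h₅ := abs_add_le (t * κ) (r * α)
  rw [abs_sign_mul hv] at h₃
  rw [abs_sign_mul hu] at h₄
  rw [abs_sign_mul ht, abs_sign_mul hr] at h₅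
  linarith

theorem twiceDist_signs_lt {p k a b c d e s₁ s₂ s₃ s₄ s₅ : ℤ} (hk : 2 * k + 1 = 5 * p)
    (hx : |a| + |b| + |c| + |d| + |e| = k + 1)
    (h₁ : s₁ = 1 ∨ s₁ = -1) (h₂ : s₂ = 1 ∨ s₂ = -1) (h₃ : s₃ = 1 ∨ s₃ = -1)
    (h₄ : s₄ = 1 ∨ s₄ = -1) (h₅ : s₅ = 1 ∨ s₅ = -1)
    (ha : 0 ≤ s₁ * a) (hb : 0 ≤ s₂ * b) (hc : 0 ≤ s₃ * c) (hd : 0 ≤ s₄ * d) (he : 0 ≤ s₅ * e)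
    (ra : 2 * (s₁ * a) ≤ 2 * p - s₁ * (s₂ * 0 + s₃ * 0 + s₄ * 1 + s₅ * -1))
    (rb : 2 * (s₂ * b) ≤ 2 * p - s₂ * (s₁ * 0 + s₃ * -1 + s₄ * 1 + s₅ * 0))
    (rc : 2 * (s₃ * c) ≤ 2 * p - s₃ * (s₁ * 0 + s₂ * 1 + s₄ * 1 + s₅ * 0))
    (rd : 2 * (s₄ * d) ≤ 2 * p - s₄ * (s₁ * -1 + s₂ * -1 + s₃ * -1 + s₅ * -1))
    (re : 2 * (s₅ * e) ≤ 2 * p - s₅ * (s₁ * 1 + s₂ * 0 + s₃ * 0 + s₄ * 1)) :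
    twiceDist p a b c d e s₁ s₂ s₃ s₄ s₅ < 2 * k + 2 := by
  have key : ∀ {s x y : ℤ}, (s = 1 ∨ s = -1) → 2 * (s * x) ≤ s * y →
      |2 * x - y| = s * y - 2 * (s * x) := by
    rintro s x y (rfl | rfl) h
    · rw [abs_of_nonpos (by linarith)]; ring
    · rw [abs_of_nonneg (by linarith)]; ring
  have sq : ∀ {s : ℤ}, (s = 1 ∨ s = -1) → s * s = 1 := by rintro s (rfl | rfl) <;> rfl
  have key' : ∀ {s x : ℤ}, (s = 1 ∨ s = -1) → 0 ≤ s * x → s * x = |x| := fun h h' => by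
    rw [← abs_sign_mul h, abs_of_nonneg h']
  rw [twiceDist, key h₁ (by linear_combination ra - 2 * p * sq h₁),
    key h₂ (by linear_combination rb - 2 * p * sq h₂),
    key h₃ (by linear_combination rc - 2 * p * sq h₃),
    key h₄ (by linear_combination rd - 2 * p * sq h₄),
    key h₅ (by linear_combination re - 2 * p * sq h₅)]
  have := key' h₁ ha
  have := key' h₂ hb
  have := key' h₃ hc
  have := key' h₄ hd
  have := key' h₅ he
  -- Antisymmetry cancels every cross term `sᵢ * sⱼ`; the total is `10p - 2(k + 1) = 2k`.
  calc _ = 10 * p - 2 * (s₁ * a + s₂ * b + s₃ * c + s₄ * d + s₅ * e) := by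
        linear_combination 2 * p * sq h₁ + 2 * p * sq h₂ + 2 * p * sq h₃ + 2 * p * sq h₄
          + 2 * p * sq h₅
    _ < 2 * k + 2 := by linarith

/-- Even coefficients give integral combinations of full rows; these are the competitors that the
sign lemmas need. -/
theorem le_of_forall_even_dist {p k a b c d e : ℤ}
    (H : FarFromLattice p k a b c d e) (A B C D E : ℤ) :
    k + 1 ≤ |a - (2 * p * A - D + E)| + |b - (2 * p * B + C - D)| + |c - (2 * p * C - B - D)|
      + |d - (2 * p * D + A + B + C + E)| + |e - (2 * p * E - A - D)| := by
  have h := H (2 * A) (2 * B) (2 * C) (2 * D) (2 * E) (by omega) (by omega) (by omega) (by omega)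
  have two : ∀ x y z : ℤ, |2 * x| = |2 * y - z| → 2 * |x| = |2 * y - z| := fun x y z h => by
    rw [← h, abs_mul]; rfl
  have e₁ := two (a - (2 * p * A - D + E)) a (2 * p * (2 * A) - 2 * D + 2 * E) (by ring_nf)
  have e₂ := two (b - (2 * p * B + C - D)) b (2 * p * (2 * B) + 2 * C - 2 * D) (by ring_nf)
  have e₃ := two (c - (2 * p * C - B - D)) c (2 * p * (2 * C) - 2 * B - 2 * D) (by ring_nf)
  have e₄ := two (d - (2 * p * D + A + B + C + E)) d
    (2 * p * (2 * D) + 2 * A + 2 * B + 2 * C + 2 * E) (by ring_nf)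
  have e₅ := two (e - (2 * p * E - A - D)) e (2 * p * (2 * E) - 2 * A - 2 * D) (by ring_nf)
  unfold twiceDist at h
  linarith

theorem FarFromLattice.false_of_rows {p k a b c d e s₁ s₂ s₃ s₄ s₅ : ℤ}
    (H : FarFromLattice p k a b c d e) (hk : 2 * k + 1 = 5 * p)
    (hx : |a| + |b| + |c| + |d| + |e| = k + 1)
    (h₁ : s₁ = 1 ∨ s₁ = -1) (h₂ : s₂ = 1 ∨ s₂ = -1) (h₃ : s₃ = 1 ∨ s₃ = -1)
    (h₄ : s₄ = 1 ∨ s₄ = -1) (h₅ : s₅ = 1 ∨ s₅ = -1)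
    (ha : 0 ≤ s₁ * a) (hb : 0 ≤ s₂ * b) (hc : 0 ≤ s₃ * c) (hd : 0 ≤ s₄ * d) (he : 0 ≤ s₅ * e)
    (ra : 2 * (s₁ * a) ≤ 2 * p - s₁ * (s₂ * 0 + s₃ * 0 + s₄ * 1 + s₅ * -1))
    (rb : 2 * (s₂ * b) ≤ 2 * p - s₂ * (s₁ * 0 + s₃ * -1 + s₄ * 1 + s₅ * 0))
    (rc : 2 * (s₃ * c) ≤ 2 * p - s₃ * (s₁ * 0 + s₂ * 1 + s₄ * 1 + s₅ * 0))
    (rd : 2 * (s₄ * d) ≤ 2 * p - s₄ * (s₁ * -1 + s₂ * -1 + s₃ * -1 + s₅ * -1))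
    (re : 2 * (s₅ * e) ≤ 2 * p - s₅ * (s₁ * 1 + s₂ * 0 + s₃ * 0 + s₄ * 1)) : False :=
  (H _ _ _ _ _ (by omega) (by omega) (by omega) (by omega)).not_gt
    (twiceDist_signs_lt hk hx h₁ h₂ h₃ h₄ h₅ ha hb hc hd he ra rb rc rd re)

/-! ### One or two large coordinates -/

theorem false_of_only_first_large {p k a b c d e : ℤ} (hp : 3 ≤ p) (hk : 2 * k + 1 = 5 * p)
    (hx : |a| + |b| + |c| + |d| + |e| = k + 1)
    (H : FarFromLattice p k a b c d e)
    (hb : |b| ≤ p - 1) (hc : |c| ≤ p - 1) (hd : |d| ≤ p - 2) (he : |e| ≤ p - 1) : False := by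
  obtain ⟨s₁, s₂, s₃, s₄, s₅, ⟨g₁, g₂, g₃, g₄, g₅⟩, ⟨ka, kb, kc, kd, ke⟩, r⟩ :=
    exists_signs_of_one_large (p := p) (X := a) (Y := b) (S := c) (U := d) (W := e)
      (κ := 0) (α := 0) (β := 1) (γ := -1)
      hp (by norm_num) (by norm_num) (by norm_num) (by norm_num)
      (fun σ => by
        have := le_of_forall_even_dist H σ 0 0 0 0
        ring_nf at this ⊢; linarith)
  exact H.false_of_rows hk hx g₁ g₂ g₃ g₄ g₅ ka kb kc kd ke
      r
      (small_row g₂ g₁ g₃ g₄ g₅ hb (by norm_num))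
      (small_row g₃ g₁ g₂ g₄ g₅ hc (by norm_num))
      (small_row g₄ g₁ g₂ g₃ g₅ hd (by norm_num))
      (small_row g₅ g₁ g₂ g₃ g₄ he (by norm_num))

theorem false_of_only_second_large {p k a b c d e : ℤ} (hp : 3 ≤ p) (hk : 2 * k + 1 = 5 * p)
    (hx : |a| + |b| + |c| + |d| + |e| = k + 1)
    (H : FarFromLattice p k a b c d e)
    (ha : |a| ≤ p - 1) (hc : |c| ≤ p - 1) (hd : |d| ≤ p - 2) (he : |e| ≤ p - 1) : False := by
  obtain ⟨s₂, s₁, s₃, s₄, s₅, ⟨g₂, g₁, g₃, g₄, g₅⟩, ⟨kb, ka, kc, kd, ke⟩, r⟩ :=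
    exists_signs_of_one_large (p := p) (X := b) (Y := a) (S := c) (U := d) (W := e)
      (κ := 0) (α := -1) (β := 1) (γ := 0)
      hp (by norm_num) (by norm_num) (by norm_num) (by norm_num)
      (fun σ => by
        have := le_of_forall_even_dist H 0 σ 0 0 0
        ring_nf at this ⊢; linarith)
  exact H.false_of_rows hk hx g₁ g₂ g₃ g₄ g₅ ka kb kc kd ke
      (small_row g₁ g₂ g₃ g₄ g₅ ha (by norm_num))
      r
      (small_row g₃ g₁ g₂ g₄ g₅ hc (by norm_num))
      (small_row g₄ g₁ g₂ g₃ g₅ hd (by norm_num))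
      (small_row g₅ g₁ g₂ g₃ g₄ he (by norm_num))

theorem false_of_only_third_large {p k a b c d e : ℤ} (hp : 3 ≤ p) (hk : 2 * k + 1 = 5 * p)
    (hx : |a| + |b| + |c| + |d| + |e| = k + 1)
    (H : FarFromLattice p k a b c d e)
    (ha : |a| ≤ p - 1) (hb : |b| ≤ p - 1) (hd : |d| ≤ p - 2) (he : |e| ≤ p - 1) : False := by
  obtain ⟨s₃, s₁, s₂, s₄, s₅, ⟨g₃, g₁, g₂, g₄, g₅⟩, ⟨kc, ka, kb, kd, ke⟩, r⟩ :=
    exists_signs_of_one_large (p := p) (X := c) (Y := a) (S := b) (U := d) (W := e)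
      (κ := 0) (α := 1) (β := 1) (γ := 0)
      hp (by norm_num) (by norm_num) (by norm_num) (by norm_num)
      (fun σ => by
        have := le_of_forall_even_dist H 0 0 σ 0 0
        ring_nf at this ⊢; linarith)
  exact H.false_of_rows hk hx g₁ g₂ g₃ g₄ g₅ ka kb kc kd ke
      (small_row g₁ g₂ g₃ g₄ g₅ ha (by norm_num))
      (small_row g₂ g₁ g₃ g₄ g₅ hb (by norm_num))
      r
      (small_row g₄ g₁ g₂ g₃ g₅ hd (by norm_num))
      (small_row g₅ g₁ g₂ g₃ g₄ he (by norm_num))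

theorem false_of_only_fourth_large {p k a b c d e : ℤ} (hp : 3 ≤ p) (hk : 2 * k + 1 = 5 * p)
    (hx : |a| + |b| + |c| + |d| + |e| = k + 1)
    (H : FarFromLattice p k a b c d e)
    (ha : |a| ≤ p - 1) (hb : |b| ≤ p - 1) (hc : |c| ≤ p - 1) (he : |e| ≤ p - 1) : False := by
  obtain ⟨s₄, s₁, s₂, s₃, s₅, ⟨g₄, g₁, g₂, g₃, g₅⟩, ⟨kd, ka, kb, kc, ke⟩, r⟩ :=
    exists_signs_of_one_large (p := p) (X := d) (Y := a) (S := b) (U := c) (W := e)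
      (κ := -1) (α := -1) (β := -1) (γ := -1)
      hp (by norm_num) (by norm_num) (by norm_num) (by norm_num)
      (fun σ => by
        have := le_of_forall_even_dist H 0 0 0 σ 0
        ring_nf at this ⊢; linarith)
  exact H.false_of_rows hk hx g₁ g₂ g₃ g₄ g₅ ka kb kc kd ke
      (small_row g₁ g₂ g₃ g₄ g₅ ha (by norm_num))
      (small_row g₂ g₁ g₃ g₄ g₅ hb (by norm_num))
      (small_row g₃ g₁ g₂ g₄ g₅ hc (by norm_num))
      r
      (small_row g₅ g₁ g₂ g₃ g₄ he (by norm_num))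

theorem false_of_only_fifth_large {p k a b c d e : ℤ} (hp : 3 ≤ p) (hk : 2 * k + 1 = 5 * p)
    (hx : |a| + |b| + |c| + |d| + |e| = k + 1)
    (H : FarFromLattice p k a b c d e)
    (ha : |a| ≤ p - 1) (hb : |b| ≤ p - 1) (hc : |c| ≤ p - 1) (hd : |d| ≤ p - 2) : False := by
  obtain ⟨s₅, s₁, s₂, s₃, s₄, ⟨g₅, g₁, g₂, g₃, g₄⟩, ⟨ke, ka, kb, kc, kd⟩, r⟩ :=
    exists_signs_of_one_large (p := p) (X := e) (Y := a) (S := b) (U := c) (W := d)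
      (κ := 1) (α := 0) (β := 0) (γ := 1)
      hp (by norm_num) (by norm_num) (by norm_num) (by norm_num)
      (fun σ => by
        have := le_of_forall_even_dist H 0 0 0 0 σ
        ring_nf at this ⊢; linarith)
  exact H.false_of_rows hk hx g₁ g₂ g₃ g₄ g₅ ka kb kc kd ke
      (small_row g₁ g₂ g₃ g₄ g₅ ha (by norm_num))
      (small_row g₂ g₁ g₃ g₄ g₅ hb (by norm_num))
      (small_row g₃ g₁ g₂ g₄ g₅ hc (by norm_num))
      (small_row g₄ g₁ g₂ g₃ g₅ hd (by norm_num))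
      r

/-- For every pair of rows, exactly one coordinate outside the pair is touched by both; it plays the
role of `S`. That is what makes the two-coordinate sign lemma apply to all ten pairs. -/
theorem false_of_first_second_large {p k a b c d e : ℤ} (hp : 3 ≤ p) (hk : 2 * k + 1 = 5 * p)
    (hx : |a| + |b| + |c| + |d| + |e| = k + 1)
    (H : FarFromLattice p k a b c d e)
    (na : a ≠ 0) (nb : b ≠ 0) (hc : |c| ≤ p - 1) (hd : |d| ≤ p - 2) (he : |e| ≤ p - 1) : False := by
  obtain ⟨s₁, s₂, s₄, s₃, s₅, ⟨g₁, g₂, g₄, g₃, g₅⟩, ⟨ka, kb, kd, kc, ke⟩, r, r'⟩ :=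
    exists_signs_of_two_large (p := p) (X := a) (Y := b) (S := d) (U := c) (W := e)
      (κ := 0) (α := 1) (β := 1) (αU := 0) (βU := -1) (αW := -1) (βW := 0)
      hp na nb (by norm_num) (by norm_num) (by norm_num) (by norm_num) (Or.inr (by norm_num))
          (Or.inl (by norm_num))
      (fun σ => by
        have := le_of_forall_even_dist H σ 0 0 0 0
        ring_nf at this ⊢; linarith)
      (fun τ => by
        have := le_of_forall_even_dist H 0 τ 0 0 0
        ring_nf at this ⊢; linarith)
      (fun σ τ => by
        have := le_of_forall_even_dist H σ τ 0 0 0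
        ring_nf at this ⊢; linarith)
  exact H.false_of_rows hk hx g₁ g₂ g₃ g₄ g₅ ka kb kc kd ke
      (by linear_combination r)
      (by linear_combination r')
      (small_row g₃ g₁ g₂ g₄ g₅ hc (by norm_num))
      (small_row g₄ g₁ g₂ g₃ g₅ hd (by norm_num))
      (small_row g₅ g₁ g₂ g₃ g₄ he (by norm_num))

theorem false_of_first_third_large {p k a b c d e : ℤ} (hp : 3 ≤ p) (hk : 2 * k + 1 = 5 * p)
    (hx : |a| + |b| + |c| + |d| + |e| = k + 1)
    (H : FarFromLattice p k a b c d e)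
    (na : a ≠ 0) (nc : c ≠ 0) (hb : |b| ≤ p - 1) (hd : |d| ≤ p - 2) (he : |e| ≤ p - 1) : False := by
  obtain ⟨s₁, s₃, s₄, s₂, s₅, ⟨g₁, g₃, g₄, g₂, g₅⟩, ⟨ka, kc, kd, kb, ke⟩, r, r'⟩ :=
    exists_signs_of_two_large (p := p) (X := a) (Y := c) (S := d) (U := b) (W := e)
      (κ := 0) (α := 1) (β := 1) (αU := 0) (βU := 1) (αW := -1) (βW := 0)
      hp na nc (by norm_num) (by norm_num) (by norm_num) (by norm_num) (Or.inr (by norm_num))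
          (Or.inl (by norm_num))
      (fun σ => by
        have := le_of_forall_even_dist H σ 0 0 0 0
        ring_nf at this ⊢; linarith)
      (fun τ => by
        have := le_of_forall_even_dist H 0 0 τ 0 0
        ring_nf at this ⊢; linarith)
      (fun σ τ => by
        have := le_of_forall_even_dist H σ 0 τ 0 0
        ring_nf at this ⊢; linarith)
  exact H.false_of_rows hk hx g₁ g₂ g₃ g₄ g₅ ka kb kc kd ke
      (by linear_combination r)
      (small_row g₂ g₁ g₃ g₄ g₅ hb (by norm_num))
      (by linear_combination r')
      (small_row g₄ g₁ g₂ g₃ g₅ hd (by norm_num))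
      (small_row g₅ g₁ g₂ g₃ g₄ he (by norm_num))

theorem false_of_first_fourth_large {p k a b c d e : ℤ} (hp : 3 ≤ p) (hk : 2 * k + 1 = 5 * p)
    (hx : |a| + |b| + |c| + |d| + |e| = k + 1)
    (H : FarFromLattice p k a b c d e)
    (na : a ≠ 0) (nd : d ≠ 0) (hb : |b| ≤ p - 1) (hc : |c| ≤ p - 1) (he : |e| ≤ p - 1) : False := by
  obtain ⟨s₁, s₄, s₅, s₂, s₃, ⟨g₁, g₄, g₅, g₂, g₃⟩, ⟨ka, kd, ke, kb, kc⟩, r, r'⟩ :=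
    exists_signs_of_two_large (p := p) (X := a) (Y := d) (S := e) (U := b) (W := c)
      (κ := 1) (α := -1) (β := -1) (αU := 0) (βU := -1) (αW := 0) (βW := -1)
      hp na nd (by norm_num) (by norm_num) (by norm_num) (by norm_num) (Or.inr (by norm_num))
          (Or.inr (by norm_num))
      (fun σ => by
        have := le_of_forall_even_dist H σ 0 0 0 0
        ring_nf at this ⊢; linarith)
      (fun τ => by
        have := le_of_forall_even_dist H 0 0 0 τ 0
        ring_nf at this ⊢; linarith)
      (fun σ τ => by
        have := le_of_forall_even_dist H σ 0 0 τ 0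
        ring_nf at this ⊢; linarith)
  exact H.false_of_rows hk hx g₁ g₂ g₃ g₄ g₅ ka kb kc kd ke
      (by linear_combination r)
      (small_row g₂ g₁ g₃ g₄ g₅ hb (by norm_num))
      (small_row g₃ g₁ g₂ g₄ g₅ hc (by norm_num))
      (by linear_combination r')
      (small_row g₅ g₁ g₂ g₃ g₄ he (by norm_num))

theorem false_of_first_fifth_large {p k a b c d e : ℤ} (hp : 3 ≤ p) (hk : 2 * k + 1 = 5 * p)
    (hx : |a| + |b| + |c| + |d| + |e| = k + 1)
    (H : FarFromLattice p k a b c d e)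
    (na : a ≠ 0) (ne : e ≠ 0) (hb : |b| ≤ p - 1) (hc : |c| ≤ p - 1) (hd : |d| ≤ p - 2) : False := by
  obtain ⟨s₁, s₅, s₄, s₂, s₃, ⟨g₁, g₅, g₄, g₂, g₃⟩, ⟨ka, ke, kd, kb, kc⟩, r, r'⟩ :=
    exists_signs_of_two_large (p := p) (X := a) (Y := e) (S := d) (U := b) (W := c)
      (κ := -1) (α := 1) (β := 1) (αU := 0) (βU := 0) (αW := 0) (βW := 0)
      hp na ne (by norm_num) (by norm_num) (by norm_num) (by norm_num) (Or.inr (by norm_num))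
          (Or.inr (by norm_num))
      (fun σ => by
        have := le_of_forall_even_dist H σ 0 0 0 0
        ring_nf at this ⊢; linarith)
      (fun τ => by
        have := le_of_forall_even_dist H 0 0 0 0 τ
        ring_nf at this ⊢; linarith)
      (fun σ τ => by
        have := le_of_forall_even_dist H σ 0 0 0 τ
        ring_nf at this ⊢; linarith)
  exact H.false_of_rows hk hx g₁ g₂ g₃ g₄ g₅ ka kb kc kd ke
      (by linear_combination r)
      (small_row g₂ g₁ g₃ g₄ g₅ hb (by norm_num))
      (small_row g₃ g₁ g₂ g₄ g₅ hc (by norm_num))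
      (small_row g₄ g₁ g₂ g₃ g₅ hd (by norm_num))
      (by linear_combination r')

theorem false_of_second_third_large {p k a b c d e : ℤ} (hp : 3 ≤ p) (hk : 2 * k + 1 = 5 * p)
    (hx : |a| + |b| + |c| + |d| + |e| = k + 1)
    (H : FarFromLattice p k a b c d e)
    (nb : b ≠ 0) (nc : c ≠ 0) (ha : |a| ≤ p - 1) (hd : |d| ≤ p - 2) (he : |e| ≤ p - 1) : False := by
  obtain ⟨s₂, s₃, s₄, s₁, s₅, ⟨g₂, g₃, g₄, g₁, g₅⟩, ⟨kb, kc, kd, ka, ke⟩, r, r'⟩ :=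
    exists_signs_of_two_large (p := p) (X := b) (Y := c) (S := d) (U := a) (W := e)
      (κ := -1) (α := 1) (β := 1) (αU := 0) (βU := 0) (αW := 0) (βW := 0)
      hp nb nc (by norm_num) (by norm_num) (by norm_num) (by norm_num) (Or.inr (by norm_num))
          (Or.inr (by norm_num))
      (fun σ => by
        have := le_of_forall_even_dist H 0 σ 0 0 0
        ring_nf at this ⊢; linarith)
      (fun τ => by
        have := le_of_forall_even_dist H 0 0 τ 0 0
        ring_nf at this ⊢; linarith)
      (fun σ τ => by
        have := le_of_forall_even_dist H 0 σ τ 0 0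
        ring_nf at this ⊢; linarith)
  exact H.false_of_rows hk hx g₁ g₂ g₃ g₄ g₅ ka kb kc kd ke
      (small_row g₁ g₂ g₃ g₄ g₅ ha (by norm_num))
      (by linear_combination r)
      (by linear_combination r')
      (small_row g₄ g₁ g₂ g₃ g₅ hd (by norm_num))
      (small_row g₅ g₁ g₂ g₃ g₄ he (by norm_num))

theorem false_of_second_fourth_large {p k a b c d e : ℤ} (hp : 3 ≤ p) (hk : 2 * k + 1 = 5 * p)
    (hx : |a| + |b| + |c| + |d| + |e| = k + 1)
    (H : FarFromLattice p k a b c d e)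
    (nb : b ≠ 0) (nd : d ≠ 0) (ha : |a| ≤ p - 1) (hc : |c| ≤ p - 1) (he : |e| ≤ p - 1) : False := by
  obtain ⟨s₂, s₄, s₃, s₁, s₅, ⟨g₂, g₄, g₃, g₁, g₅⟩, ⟨kb, kd, kc, ka, ke⟩, r, r'⟩ :=
    exists_signs_of_two_large (p := p) (X := b) (Y := d) (S := c) (U := a) (W := e)
      (κ := 1) (α := -1) (β := -1) (αU := 0) (βU := -1) (αW := 0) (βW := -1)
      hp nb nd (by norm_num) (by norm_num) (by norm_num) (by norm_num) (Or.inr (by norm_num))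
          (Or.inr (by norm_num))
      (fun σ => by
        have := le_of_forall_even_dist H 0 σ 0 0 0
        ring_nf at this ⊢; linarith)
      (fun τ => by
        have := le_of_forall_even_dist H 0 0 0 τ 0
        ring_nf at this ⊢; linarith)
      (fun σ τ => by
        have := le_of_forall_even_dist H 0 σ 0 τ 0
        ring_nf at this ⊢; linarith)
  exact H.false_of_rows hk hx g₁ g₂ g₃ g₄ g₅ ka kb kc kd ke
      (small_row g₁ g₂ g₃ g₄ g₅ ha (by norm_num))
      (by linear_combination r)
      (small_row g₃ g₁ g₂ g₄ g₅ hc (by norm_num))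
      (by linear_combination r')
      (small_row g₅ g₁ g₂ g₃ g₄ he (by norm_num))

theorem false_of_second_fifth_large {p k a b c d e : ℤ} (hp : 3 ≤ p) (hk : 2 * k + 1 = 5 * p)
    (hx : |a| + |b| + |c| + |d| + |e| = k + 1)
    (H : FarFromLattice p k a b c d e)
    (nb : b ≠ 0) (ne : e ≠ 0) (ha : |a| ≤ p - 1) (hc : |c| ≤ p - 1) (hd : |d| ≤ p - 2) : False := by
  obtain ⟨s₂, s₅, s₄, s₁, s₃, ⟨g₂, g₅, g₄, g₁, g₃⟩, ⟨kb, ke, kd, ka, kc⟩, r, r'⟩ :=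
    exists_signs_of_two_large (p := p) (X := b) (Y := e) (S := d) (U := a) (W := c)
      (κ := 0) (α := 1) (β := 1) (αU := 0) (βU := 1) (αW := -1) (βW := 0)
      hp nb ne (by norm_num) (by norm_num) (by norm_num) (by norm_num) (Or.inr (by norm_num))
          (Or.inl (by norm_num))
      (fun σ => by
        have := le_of_forall_even_dist H 0 σ 0 0 0
        ring_nf at this ⊢; linarith)
      (fun τ => by
        have := le_of_forall_even_dist H 0 0 0 0 τ
        ring_nf at this ⊢; linarith)
      (fun σ τ => by
        have := le_of_forall_even_dist H 0 σ 0 0 τ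
        ring_nf at this ⊢; linarith)
  exact H.false_of_rows hk hx g₁ g₂ g₃ g₄ g₅ ka kb kc kd ke
      (small_row g₁ g₂ g₃ g₄ g₅ ha (by norm_num))
      (by linear_combination r)
      (small_row g₃ g₁ g₂ g₄ g₅ hc (by norm_num))
      (small_row g₄ g₁ g₂ g₃ g₅ hd (by norm_num))
      (by linear_combination r')

theorem false_of_third_fourth_large {p k a b c d e : ℤ} (hp : 3 ≤ p) (hk : 2 * k + 1 = 5 * p)
    (hx : |a| + |b| + |c| + |d| + |e| = k + 1)
    (H : FarFromLattice p k a b c d e)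
    (nc : c ≠ 0) (nd : d ≠ 0) (ha : |a| ≤ p - 1) (hb : |b| ≤ p - 1) (he : |e| ≤ p - 1) : False := by
  obtain ⟨s₃, s₄, s₂, s₁, s₅, ⟨g₃, g₄, g₂, g₁, g₅⟩, ⟨kc, kd, kb, ka, ke⟩, r, r'⟩ :=
    exists_signs_of_two_large (p := p) (X := c) (Y := d) (S := b) (U := a) (W := e)
      (κ := 1) (α := 1) (β := -1) (αU := 0) (βU := -1) (αW := 0) (βW := -1)
      hp nc nd (by norm_num) (by norm_num) (by norm_num) (by norm_num) (Or.inr (by norm_num))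
          (Or.inr (by norm_num))
      (fun σ => by
        have := le_of_forall_even_dist H 0 0 σ 0 0
        ring_nf at this ⊢; linarith)
      (fun τ => by
        have := le_of_forall_even_dist H 0 0 0 τ 0
        ring_nf at this ⊢; linarith)
      (fun σ τ => by
        have := le_of_forall_even_dist H 0 0 σ τ 0
        ring_nf at this ⊢; linarith)
  exact H.false_of_rows hk hx g₁ g₂ g₃ g₄ g₅ ka kb kc kd ke
      (small_row g₁ g₂ g₃ g₄ g₅ ha (by norm_num))
      (small_row g₂ g₁ g₃ g₄ g₅ hb (by norm_num))
      (by linear_combination r)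
      (by linear_combination r')
      (small_row g₅ g₁ g₂ g₃ g₄ he (by norm_num))

theorem false_of_third_fifth_large {p k a b c d e : ℤ} (hp : 3 ≤ p) (hk : 2 * k + 1 = 5 * p)
    (hx : |a| + |b| + |c| + |d| + |e| = k + 1)
    (H : FarFromLattice p k a b c d e)
    (nc : c ≠ 0) (ne : e ≠ 0) (ha : |a| ≤ p - 1) (hb : |b| ≤ p - 1) (hd : |d| ≤ p - 2) : False := by
  obtain ⟨s₃, s₅, s₄, s₁, s₂, ⟨g₃, g₅, g₄, g₁, g₂⟩, ⟨kc, ke, kd, ka, kb⟩, r, r'⟩ :=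
    exists_signs_of_two_large (p := p) (X := c) (Y := e) (S := d) (U := a) (W := b)
      (κ := 0) (α := 1) (β := 1) (αU := 0) (βU := 1) (αW := 1) (βW := 0)
      hp nc ne (by norm_num) (by norm_num) (by norm_num) (by norm_num) (Or.inr (by norm_num))
          (Or.inl (by norm_num))
      (fun σ => by
        have := le_of_forall_even_dist H 0 0 σ 0 0
        ring_nf at this ⊢; linarith)
      (fun τ => by
        have := le_of_forall_even_dist H 0 0 0 0 τ
        ring_nf at this ⊢; linarith)
      (fun σ τ => by
        have := le_of_forall_even_dist H 0 0 σ 0 τ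
        ring_nf at this ⊢; linarith)
  exact H.false_of_rows hk hx g₁ g₂ g₃ g₄ g₅ ka kb kc kd ke
      (small_row g₁ g₂ g₃ g₄ g₅ ha (by norm_num))
      (small_row g₂ g₁ g₃ g₄ g₅ hb (by norm_num))
      (by linear_combination r)
      (small_row g₄ g₁ g₂ g₃ g₅ hd (by norm_num))
      (by linear_combination r')

theorem false_of_fourth_fifth_large {p k a b c d e : ℤ} (hp : 3 ≤ p) (hk : 2 * k + 1 = 5 * p)
    (hx : |a| + |b| + |c| + |d| + |e| = k + 1)
    (H : FarFromLattice p k a b c d e)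
    (nd : d ≠ 0) (ne : e ≠ 0) (ha : |a| ≤ p - 1) (hb : |b| ≤ p - 1) (hc : |c| ≤ p - 1) : False := by
  obtain ⟨s₄, s₅, s₁, s₂, s₃, ⟨g₄, g₅, g₁, g₂, g₃⟩, ⟨kd, ke, ka, kb, kc⟩, r, r'⟩ :=
    exists_signs_of_two_large (p := p) (X := d) (Y := e) (S := a) (U := b) (W := c)
      (κ := -1) (α := -1) (β := 1) (αU := -1) (βU := 0) (αW := -1) (βW := 0)
      hp nd ne (by norm_num) (by norm_num) (by norm_num) (by norm_num) (Or.inl (by norm_num))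
          (Or.inl (by norm_num))
      (fun σ => by
        have := le_of_forall_even_dist H 0 0 0 σ 0
        ring_nf at this ⊢; linarith)
      (fun τ => by
        have := le_of_forall_even_dist H 0 0 0 0 τ
        ring_nf at this ⊢; linarith)
      (fun σ τ => by
        have := le_of_forall_even_dist H 0 0 0 σ τ
        ring_nf at this ⊢; linarith)
  exact H.false_of_rows hk hx g₁ g₂ g₃ g₄ g₅ ka kb kc kd ke
      (small_row g₁ g₂ g₃ g₄ g₅ ha (by norm_num))
      (small_row g₂ g₁ g₃ g₄ g₅ hb (by norm_num))
      (small_row g₃ g₁ g₂ g₄ g₅ hc (by norm_num))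
      (by linear_combination r)
      (by linear_combination r')

/-! ### Three large coordinates, and the covering bound -/

theorem FarFromLattice.ne {p k a b c d e x₁ x₂ x₃ x₄ x₅ : ℤ}
    (H : FarFromLattice p k a b c d e) {A B C D E : ℤ}
    (h : (2 ∣ A - B ∧ 2 ∣ A - C ∧ 2 ∣ A - D ∧ 2 ∣ A - E) ∧
      twiceDist p x₁ x₂ x₃ x₄ x₅ A B C D E < 2 * k + 2) :
    ¬(a = x₁ ∧ b = x₂ ∧ c = x₃ ∧ d = x₄ ∧ e = x₅) := by
  rintro ⟨rfl, rfl, rfl, rfl, rfl⟩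
  exact (H A B C D E h.1.1 h.1.2.1 h.1.2.2.1 h.1.2.2.2).not_gt h.2

/-- The only case in which three coordinates can be large. -/
theorem false_of_three_large {a b c d e : ℤ} (H : FarFromLattice 3 7 a b c d e)
    (hx : |a| + |b| + |c| + |d| + |e| = 8) (hd : |d| = 2) (ha : |a| = 3 ∨ |a| = 0)
    (hb : |b| = 3 ∨ |b| = 0) (hc : |c| = 3 ∨ |c| = 0) (he : |e| = 3 ∨ |e| = 0) : False := by
  have three : ∀ {x : ℤ}, |x| = 3 ∨ |x| = 0 → x = 3 ∨ x = -3 ∨ x = 0 := by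
    rintro x (h | h)
    · rcases (abs_eq (by norm_num)).1 h with h | h <;> simp [h]
    · exact Or.inr (Or.inr (abs_eq_zero.1 h))
  -- Norm 8 leaves `d = ±2` and two further entries `±3`. Each such vector is within 7 of one of the
  -- listed lattice vectors.
  rcases (abs_eq (by norm_num)).1 hd with rfl | rfl <;> rcases three ha with rfl | rfl | rfl <;>
    rcases three hb with rfl | rfl | rfl <;> rcases three hc with rfl | rfl | rfl <;>
    rcases three he with rfl | rfl | rfl <;> first
    | exact absurd hx (by decide)
    | exact H.ne (A := -1) (B := -1) (C := -1) (D := 1) (E := 1) (by decide)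
        ⟨rfl, rfl, rfl, rfl, rfl⟩
    | exact H.ne (A := 1) (B := 1) (C := -1) (D := -1) (E := -1) (by decide)
        ⟨rfl, rfl, rfl, rfl, rfl⟩
    | exact H.ne (A := -1) (B := -1) (C := 1) (D := 1) (E := -1) (by decide)
        ⟨rfl, rfl, rfl, rfl, rfl⟩
    | exact H.ne (A := -1) (B := 1) (C := 1) (D := -1) (E := -1) (by decide)
        ⟨rfl, rfl, rfl, rfl, rfl⟩
    | exact H.ne (A := 1) (B := -1) (C := -1) (D := -1) (E := 1) (by decide)
        ⟨rfl, rfl, rfl, rfl, rfl⟩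
    | exact H.ne (A := -1) (B := 1) (C := -1) (D := -1) (E := 1) (by decide)
        ⟨rfl, rfl, rfl, rfl, rfl⟩
    | exact H.ne (A := -1) (B := 1) (C := 1) (D := 1) (E := -1) (by decide)
        ⟨rfl, rfl, rfl, rfl, rfl⟩
    | exact H.ne (A := 1) (B := -1) (C := -1) (D := 1) (E := 1) (by decide)
        ⟨rfl, rfl, rfl, rfl, rfl⟩
    | exact H.ne (A := 1) (B := -1) (C := 1) (D := -1) (E := -1) (by decide)
        ⟨rfl, rfl, rfl, rfl, rfl⟩
    | exact H.ne (A := -1) (B := -1) (C := -1) (D := -1) (E := -1) (by decide)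
        ⟨rfl, rfl, rfl, rfl, rfl⟩
    | exact H.ne (A := -1) (B := -1) (C := 1) (D := -1) (E := 1) (by decide)
        ⟨rfl, rfl, rfl, rfl, rfl⟩
    | exact H.ne (A := -1) (B := -1) (C := 1) (D := 1) (E := 1) (by decide)
        ⟨rfl, rfl, rfl, rfl, rfl⟩
    | exact H.ne (A := -1) (B := 1) (C := -1) (D := -1) (E := -1) (by decide)
        ⟨rfl, rfl, rfl, rfl, rfl⟩
    | exact H.ne (A := -1) (B := 1) (C := -1) (D := 1) (E := -1) (by decide)
        ⟨rfl, rfl, rfl, rfl, rfl⟩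
    | exact H.ne (A := -1) (B := 1) (C := 1) (D := 1) (E := 1) (by decide)
        ⟨rfl, rfl, rfl, rfl, rfl⟩
    | exact H.ne (A := 1) (B := -1) (C := -1) (D := -1) (E := -1) (by decide)
        ⟨rfl, rfl, rfl, rfl, rfl⟩
    | exact H.ne (A := 1) (B := -1) (C := 1) (D := 1) (E := 1) (by decide)
        ⟨rfl, rfl, rfl, rfl, rfl⟩
    | exact H.ne (A := 1) (B := 1) (C := 1) (D := 1) (E := 1) (by decide)
        ⟨rfl, rfl, rfl, rfl, rfl⟩
    | exact H.ne (A := -2) (B := 0) (C := 0) (D := 0) (E := -2) (by decide)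
        ⟨rfl, rfl, rfl, rfl, rfl⟩
    | exact H.ne (A := -2) (B := 0) (C := 0) (D := 0) (E := 0) (by decide)
        ⟨rfl, rfl, rfl, rfl, rfl⟩
    | exact H.ne (A := 0) (B := -2) (C := -2) (D := 0) (E := 0) (by decide)
        ⟨rfl, rfl, rfl, rfl, rfl⟩
    | exact H.ne (A := 0) (B := -2) (C := 0) (D := 0) (E := 0) (by decide)
        ⟨rfl, rfl, rfl, rfl, rfl⟩
    | exact H.ne (A := 0) (B := 0) (C := 0) (D := 0) (E := 2) (by decide)
        ⟨rfl, rfl, rfl, rfl, rfl⟩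
    | exact H.ne (A := 0) (B := 0) (C := 2) (D := 0) (E := 0) (by decide)
        ⟨rfl, rfl, rfl, rfl, rfl⟩
    | exact H.ne (A := 0) (B := 2) (C := 0) (D := 0) (E := 0) (by decide)
        ⟨rfl, rfl, rfl, rfl, rfl⟩
    | exact H.ne (A := 2) (B := 0) (C := 0) (D := 0) (E := 0) (by decide)
        ⟨rfl, rfl, rfl, rfl, rfl⟩

theorem not_farFromLattice {p k a b c d e : ℤ} (hp : 3 ≤ p) (hk : 2 * k + 1 = 5 * p)
    (hx : |a| + |b| + |c| + |d| + |e| = k + 1) : ¬FarFromLattice p k a b c d e := by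
  intro H
  have pos := And.intro (abs_nonneg a) <| And.intro (abs_nonneg b) <| And.intro (abs_nonneg c) <|
    And.intro (abs_nonneg d) (abs_nonneg e)
  have ne : ∀ {x : ℤ}, 1 ≤ |x| → x ≠ 0 := by rintro x h rfl; simp at h
  by_cases ha : |a| ≤ p - 1 <;> by_cases hb : |b| ≤ p - 1 <;> by_cases hc : |c| ≤ p - 1 <;>
    by_cases hd : |d| ≤ p - 2 <;> by_cases he : |e| ≤ p - 1 <;> first
    | exact false_of_only_first_large hp hk hx H hb hc hd he
    | exact false_of_only_second_large hp hk hx H ha hc hd he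
    | exact false_of_only_third_large hp hk hx H ha hb hd he
    | exact false_of_only_fourth_large hp hk hx H ha hb hc he
    | exact false_of_only_fifth_large hp hk hx H ha hb hc hd
    | exact false_of_first_second_large hp hk hx H (ne (by omega)) (ne (by omega)) hc hd he
    | exact false_of_first_third_large hp hk hx H (ne (by omega)) (ne (by omega)) hb hd he
    | exact false_of_first_fourth_large hp hk hx H (ne (by omega)) (ne (by omega)) hb hc he
    | exact false_of_first_fifth_large hp hk hx H (ne (by omega)) (ne (by omega)) hb hc hd
    | exact false_of_second_third_large hp hk hx H (ne (by omega)) (ne (by omega)) ha hd he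
    | exact false_of_second_fourth_large hp hk hx H (ne (by omega)) (ne (by omega)) ha hc he
    | exact false_of_second_fifth_large hp hk hx H (ne (by omega)) (ne (by omega)) ha hc hd
    | exact false_of_third_fourth_large hp hk hx H (ne (by omega)) (ne (by omega)) ha hb he
    | exact false_of_third_fifth_large hp hk hx H (ne (by omega)) (ne (by omega)) ha hb hd
    | exact false_of_fourth_fifth_large hp hk hx H (ne (by omega)) (ne (by omega)) ha hb hc
    | omega
    -- Three large coordinates have norm at least `3p - 1`, while `k + 1 = (5p + 1) / 2`; this
    -- forces `p = 3` and equality throughout.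
    | obtain rfl : p = 3 := by omega
      obtain rfl : k = 7 := by omega
      exact false_of_three_large H hx (by omega) (by omega) (by omega) (by omega) (by omega)

/-! ### A point at distance `k` from the lattice -/

/-- A point of norm `15 * m + 7` halfway between the origin and a half-sum of the long vectors is
at least that far from every vector of the lattice, provided the coefficients are small. -/
theorem lt_norm_of_small_coeffs {m a b c d e A B C D E : ℤ} (_hm : 0 ≤ m)
    (ha : 2 * a = 6 * m + 4 - (2 * (6 * m + 3) * A - D + E))
    (hb : 2 * b = 6 * m + 2 - (2 * (6 * m + 3) * B + C - D))
    (hc : 2 * c = 6 * m + 2 - (2 * (6 * m + 3) * C - B - D))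
    (hd : 2 * d = 6 * m + 4 - (2 * (6 * m + 3) * D + A + B + C + E))
    (he : 2 * e = 6 * m + 2 - (2 * (6 * m + 3) * E - A - D))
    (hA : -1 ≤ A ∧ A ≤ 2) (hB : -1 ≤ B ∧ B ≤ 2) (hC : -1 ≤ C ∧ C ≤ 2) (hD : -1 ≤ D ∧ D ≤ 2)
    (hE : -1 ≤ E ∧ E ≤ 2) : 15 * m + 6 < |a| + |b| + |c| + |d| + |e| := by
  have a₁ := le_abs_self a
  have a₂ := neg_le_abs a
  have b₁ := le_abs_self b
  have b₂ := neg_le_abs b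
  have c₁ := le_abs_self c
  have c₂ := neg_le_abs c
  have d₁ := le_abs_self d
  have d₂ := neg_le_abs d
  have e₁ := le_abs_self e
  have e₂ := neg_le_abs e
  obtain ⟨A₁, A₂⟩ := hA
  obtain ⟨B₁, B₂⟩ := hB
  obtain ⟨C₁, C₂⟩ := hC
  obtain ⟨D₁, D₂⟩ := hD
  obtain ⟨E₁, E₂⟩ := hE
  -- With fixed coefficients the system is linear in `m`. Many branches close before all five are
  -- fixed.
  interval_cases A <;> interval_cases D <;> first
    | omega
    | interval_cases B <;> first
      | omega
      | interval_cases C <;> first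
        | omega
        | interval_cases E <;> omega

theorem lt_norm_of_eq {m a b c d e A B C D E : ℤ} (hm : 0 ≤ m)
    (ha : 2 * a = 6 * m + 4 - (2 * (6 * m + 3) * A - D + E))
    (hb : 2 * b = 6 * m + 2 - (2 * (6 * m + 3) * B + C - D))
    (hc : 2 * c = 6 * m + 2 - (2 * (6 * m + 3) * C - B - D))
    (hd : 2 * d = 6 * m + 4 - (2 * (6 * m + 3) * D + A + B + C + E))
    (he : 2 * e = 6 * m + 2 - (2 * (6 * m + 3) * E - A - D)) :
    15 * m + 6 < |a| + |b| + |c| + |d| + |e| := by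
  by_contra! h
  refine h.not_gt ?_
  suffices (-1 ≤ A ∧ A ≤ 2) ∧ (-1 ≤ B ∧ B ≤ 2) ∧ (-1 ≤ C ∧ C ≤ 2) ∧ (-1 ≤ D ∧ D ≤ 2) ∧
      (-1 ≤ E ∧ E ≤ 2) from
    lt_norm_of_small_coeffs hm ha hb hc hd he this.1 this.2.1 this.2.2.1 this.2.2.2.1 this.2.2.2.2
  -- The size estimate below is too weak for `m = 0`, where the linear system bounds the
  -- coefficients directly.
  obtain rfl | hm := hm.eq_or_lt
  · have a₁ := le_abs_self a
    have a₂ := neg_le_abs a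
    have b₁ := le_abs_self b
    have b₂ := neg_le_abs b
    have c₁ := le_abs_self c
    have c₂ := neg_le_abs c
    have d₁ := le_abs_self d
    have d₂ := neg_le_abs d
    have e₁ := le_abs_self e
    have e₂ := neg_le_abs e
    refine ⟨⟨?_, ?_⟩, ⟨?_, ?_⟩, ⟨?_, ?_⟩, ⟨?_, ?_⟩, ⟨?_, ?_⟩⟩ <;> linarith
  · have key : ∀ {x w X y z t u : ℤ},
        2 * x = 6 * m + 3 + w - (2 * (6 * m + 3) * X + (y + z + t + u)) →
        |w| ≤ 1 → (6 * m + 3) * |2 * X - 1| ≤ 2 * |x| + 1 + (|y| + |z| + |t| + |u|) := by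
      intro x w X y z t u h hw
      have h₀ : (6 * m + 3) * |2 * X - 1| = |(6 * m + 3) * (2 * X - 1)| := by
        rw [abs_mul, abs_of_pos (show 0 < 6 * m + 3 by linarith)]
      have h₁ : (6 * m + 3) * (2 * X - 1) = w - (y + z + t + u) - 2 * x := by linarith
      have h₂ := abs_sub (w - (y + z + t + u)) (2 * x)
      have h₃ := abs_sub w (y + z + t + u)
      have h₄ := abs_add_le (y + z + t) u
      have h₅ := abs_add_le (y + z) t
      have h₆ := abs_add_le y z
      have h₇ : |2 * x| = 2 * |x| := by rw [abs_mul]; rfl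
      rw [h₀, h₁]
      linarith
    have ka := key (x := a) (w := 1) (X := A) (y := -D) (z := E) (t := 0) (u := 0)
      (by linarith) (by norm_num)
    have kb := key (x := b) (w := -1) (X := B) (y := C) (z := -D) (t := 0) (u := 0)
      (by linarith) (by norm_num)
    have kc := key (x := c) (w := -1) (X := C) (y := -B) (z := -D) (t := 0) (u := 0)
      (by linarith) (by norm_num)
    have kd := key (x := d) (w := 1) (X := D) (y := A) (z := B) (t := C) (u := E)
      (by linarith) (by norm_num)
    have ke := key (x := e) (w := -1) (X := E) (y := -A) (z := -D) (t := 0) (u := 0)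
      (by linarith) (by norm_num)
    simp only [abs_neg, abs_zero] at ka kb kc kd ke
    have bound : ∀ X : ℤ, 2 * |X| ≤ |2 * X - 1| + 1 ∧ 1 ≤ |2 * X - 1| := fun X => by
      have := abs_add_le (2 * X - 1) 1
      have h₇ : |2 * X - 1 + 1| = 2 * |X| := by rw [sub_add_cancel, abs_mul]; rfl
      exact ⟨by rw [← h₇]; simpa using this, Int.one_le_abs (by omega)⟩
    obtain ⟨A₁, A₂⟩ := bound A
    obtain ⟨B₁, B₂⟩ := bound B
    obtain ⟨C₁, C₂⟩ := bound C
    obtain ⟨D₁, D₂⟩ := bound D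
    obtain ⟨E₁, E₂⟩ := bound E
    -- Let `T` be this sum. Adding the five estimates, where `D` occurs four times off the diagonal
    -- and the others twice, gives `(6m + 1) T ≤ 30m + 19`. As each term is at least 1, `T < 9`
    -- leaves each below 5.
    have hS : |2 * A - 1| + |2 * B - 1| + |2 * C - 1| + |2 * D - 1| + |2 * E - 1| < 9 := by
      by_contra! hS
      have := mul_le_mul_of_nonneg_left hS (show 0 ≤ 6 * m + 1 by linarith)
      linarith
    have fin : ∀ X : ℤ, |2 * X - 1| < 5 → -1 ≤ X ∧ X ≤ 2 := fun X h => by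
      rw [abs_lt] at h; omega
    exact ⟨fin A (by linarith), fin B (by linarith), fin C (by linarith), fin D (by linarith),
      fin E (by linarith)⟩

/-! ### The lattice as the kernel of the weight map -/

def orderPoly (t : ℤ) : ℤ := 15 * t + 648 * t ^ 3 + 3888 * t ^ 5

def genPoly₁ (t : ℤ) : ℤ := 1 + 90 * t ^ 2 + 648 * t ^ 4

def genPoly₂ (t : ℤ) : ℤ := -1 - 3 * t - 42 * t ^ 2 + 144 * t ^ 3 - 216 * t ^ 4 + 1296 * t ^ 5

def genPoly₃ (t : ℤ) : ℤ := -1 + 6 * t - 42 * t ^ 2 + 252 * t ^ 3 - 216 * t ^ 4 + 1296 * t ^ 5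

def genPoly₄ (t : ℤ) : ℤ := -1 + 12 * t - 42 * t ^ 2 + 252 * t ^ 3 - 216 * t ^ 4 + 1296 * t ^ 5

/-- The residue reached by a vector of steps. -/
def weight (t a b c d e : ℤ) : ℤ :=
  a + b * genPoly₁ t + c * genPoly₂ t + d * genPoly₃ t + e * genPoly₄ t

/-- A vector of weight zero is a half-integral combination of the long vectors. -/
theorem exists_coeffs_of_dvd_weight {t a b c d e : ℤ} (h : orderPoly t ∣ weight t a b c d e) :
    ∃ A B C D E : ℤ, 2 * a = 2 * (3 * t) * A - D + E ∧ 2 * b = 2 * (3 * t) * B + C - D ∧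
      2 * c = 2 * (3 * t) * C - B - D ∧ 2 * d = 2 * (3 * t) * D + A + B + C + E ∧
      2 * e = 2 * (3 * t) * E - A - D := by
  obtain ⟨q, hq⟩ := h
  obtain rfl : a = orderPoly t * q
      - (b * genPoly₁ t + c * genPoly₂ t + d * genPoly₃ t + e * genPoly₄ t) := by
    unfold weight at hq; linarith
  clear hq
  -- The solution of the linear system, with `a` eliminated in favour of the quotient `q`; its
  -- coefficients are integral.
  refine ⟨(1 + 144 * t ^ 2 + 1296 * t ^ 4) * q + (-18 * t - 216 * t ^ 3) * b + (1 + 10 * t - 24 * t ^ 2 + 72 * t ^ 3 - 432 * t ^ 4) * c + (10 * t - 60 * t ^ 2 + 72 * t ^ 3 - 432 * t ^ 4) * d + (-2 + 10 * t - 60 * t ^ 2 + 72 * t ^ 3 - 432 * t ^ 4) * e,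
    (1 - 36 * t ^ 2) * q + (6 * t) * b + (-1 - 2 * t + 12 * t ^ 2) * c + (-2 * t + 12 * t ^ 2) * d + (-2 * t + 12 * t ^ 2) * e,
    (-1 - 12 * t - 36 * t ^ 2) * q + (2 + 6 * t) * b + (-1 + 2 * t + 12 * t ^ 2) * c + (2 * t + 12 * t ^ 2) * d + (2 * t + 12 * t ^ 2) * e,
    (-1 - 6 * t - 36 * t ^ 2 - 216 * t ^ 3) * q + (6 * t + 36 * t ^ 2) * b + (-1 - 4 * t + 72 * t ^ 3) * c + (2 * t + 72 * t ^ 3) * d + (2 * t + 72 * t ^ 3) * e,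
    (-1 + 18 * t - 36 * t ^ 2 + 216 * t ^ 3) * q + (-2 + 6 * t - 36 * t ^ 2) * b + (1 - 4 * t + 24 * t ^ 2 - 72 * t ^ 3) * c + (2 - 10 * t + 24 * t ^ 2 - 72 * t ^ 3) * d + (2 - 10 * t + 24 * t ^ 2 - 72 * t ^ 3) * e,
    ?_, ?_, ?_, ?_, ?_⟩
  · simp only [orderPoly, genPoly₁, genPoly₂, genPoly₃, genPoly₄]
    ring
  all_goals ring

theorem orderPoly_dvd_weight {t a b c d e A B C D E : ℤ} (hBD : 2 ∣ B - D)
    (ha : 2 * a = 2 * (3 * t) * A - D + E) (hb : 2 * b = 2 * (3 * t) * B + C - D)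
    (hc : 2 * c = 2 * (3 * t) * C - B - D) (hd : 2 * d = 2 * (3 * t) * D + A + B + C + E)
    (he : 2 * e = 2 * (3 * t) * E - A - D) : orderPoly t ∣ weight t a b c d e := by
  obtain ⟨f, hf⟩ := hBD
  -- The five rows have weights `0, 1, 2t, 2t - 1, 2t` times `orderPoly t`; the quotient is half of
  -- their combination.
  refine ⟨f + t * (C + D + E), mul_left_cancel₀ (two_ne_zero (α := ℤ)) ?_⟩
  obtain rfl : B = D + 2 * f := by linarith
  simp only [weight, orderPoly, genPoly₁, genPoly₂, genPoly₃, genPoly₄]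
  linear_combination ha + hb * (1 + 90 * t ^ 2 + 648 * t ^ 4) + hc * (-1 - 3 * t - 42 * t ^ 2 + 144 * t ^ 3 - 216 * t ^ 4 + 1296 * t ^ 5)
    + hd * (-1 + 6 * t - 42 * t ^ 2 + 252 * t ^ 3 - 216 * t ^ 4 + 1296 * t ^ 5) + he * (-1 + 12 * t - 42 * t ^ 2 + 252 * t ^ 3 - 216 * t ^ 4 + 1296 * t ^ 5)

theorem exists_short_of_norm_eq {t k a b c d e : ℤ} (ht : 1 ≤ t) (hk : 2 * k + 1 = 15 * t) (hx : |a| + |b| + |c| + |d| + |e| = k + 1) :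
    ∃ a' b' c' d' e' : ℤ, |a'| + |b'| + |c'| + |d'| + |e'| ≤ k ∧
      orderPoly t ∣ weight t a b c d e - weight t a' b' c' d' e' := by
  have h := not_farFromLattice (p := 3 * t) (by linarith) (by linarith) hx
  simp only [FarFromLattice, not_forall, not_le] at h
  obtain ⟨A, B, C, D, E, hB, hC, hD, hE, h⟩ := h
  -- Writing the coefficients as `A` minus even numbers makes the half-sum visibly integral.
  obtain ⟨B, rfl⟩ : ∃ B', B = A - 2 * B' := ⟨_, by rw [← hB.choose_spec]; ring⟩
  obtain ⟨C, rfl⟩ : ∃ C', C = A - 2 * C' := ⟨_, by rw [← hC.choose_spec]; ring⟩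
  obtain ⟨D, rfl⟩ : ∃ D', D = A - 2 * D' := ⟨_, by rw [← hD.choose_spec]; ring⟩
  obtain ⟨E, rfl⟩ : ∃ E', E = A - 2 * E' := ⟨_, by rw [← hE.choose_spec]; ring⟩
  have half : ∀ x y z : ℤ, z = 2 * y → |2 * x - z| = 2 * |x - y| := by
    rintro x y _ rfl; rw [← mul_sub, abs_mul]; rfl
  refine ⟨a - (3 * t * A + D - E), b - (3 * t * (A - 2 * B) - C + D),
    c - (3 * t * (A - 2 * C) - A + B + D), d - (3 * t * (A - 2 * D) + 2 * A - B - C - E),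
    e - (3 * t * (A - 2 * E) - A + D), ?_, ?_⟩
  · rw [twiceDist, half a (3 * t * A + D - E) _ (by ring),
      half b (3 * t * (A - 2 * B) - C + D) _ (by ring),
      half c (3 * t * (A - 2 * C) - A + B + D) _ (by ring),
      half d (3 * t * (A - 2 * D) + 2 * A - B - C - E) _ (by ring),
      half e (3 * t * (A - 2 * E) - A + D) _ (by ring)] at h
    linarith
  · have := orderPoly_dvd_weight (t := t) (a := 3 * t * A + D - E)
      (b := 3 * t * (A - 2 * B) - C + D) (c := 3 * t * (A - 2 * C) - A + B + D)
      (d := 3 * t * (A - 2 * D) + 2 * A - B - C - E) (e := 3 * t * (A - 2 * E) - A + D)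
      (A := A) (B := A - 2 * B) (C := A - 2 * C) (D := A - 2 * D) (E := A - 2 * E)
      ⟨D - B, by ring⟩ (by ring) (by ring) (by ring) (by ring) (by ring)
    convert this using 1
    unfold weight
    ring

/-- Passing from `z` to `z + 1` changes only the coefficient of the generator 1, so the norm exceeds
`k` by at most one and a single shortening restores the bound. -/
theorem exists_short {t k : ℤ} (ht : 1 ≤ t) (hk : 2 * k + 1 = 15 * t) (z : ℕ) :
    ∃ a b c d e : ℤ, |a| + |b| + |c| + |d| + |e| ≤ k ∧ orderPoly t ∣ z - weight t a b c d e := by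
  induction z with
  | zero => exact ⟨0, 0, 0, 0, 0, by simp; linarith, by simp [weight]⟩
  | succ z ih =>
    obtain ⟨a, b, c, d, e, h, hz⟩ := ih
    have hz' : orderPoly t ∣ (z + 1 : ℕ) - weight t (a + 1) b c d e := by
      convert hz using 1; push_cast; unfold weight; ring
    have ha := abs_add_le a 1
    rw [abs_one] at ha
    rcases le_or_gt (|a + 1| + |b| + |c| + |d| + |e|) k with hle | hlt
    · exact ⟨_, _, _, _, _, hle, hz'⟩
    · obtain ⟨a', b', c', d', e', h', hw⟩ :=
        exists_short_of_norm_eq ht hk (a := a + 1) (b := b) (c := c) (d := d) (e := e)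
          (by linarith)
      exact ⟨_, _, _, _, _, h', by simpa using hz'.add hw⟩

theorem lt_norm_of_dvd_weight_sub {m a b c d e : ℤ} (hm : 0 ≤ m)
    (h : orderPoly (2 * m + 1) ∣ weight (2 * m + 1) (3 * m + 2) (3 * m + 1) (3 * m + 1)
      (3 * m + 2) (3 * m + 1) - weight (2 * m + 1) a b c d e) :
    15 * m + 6 < |a| + |b| + |c| + |d| + |e| := by
  have h' : orderPoly (2 * m + 1) ∣ weight (2 * m + 1) (3 * m + 2 - a) (3 * m + 1 - b)
      (3 * m + 1 - c) (3 * m + 2 - d) (3 * m + 1 - e) := by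
    convert h using 1; unfold weight; ring
  obtain ⟨A, B, C, D, E, ha, hb, hc, hd, he⟩ := exists_coeffs_of_dvd_weight h'
  exact lt_norm_of_eq (A := A) (B := B) (C := C) (D := D) (E := E) hm (by linear_combination -ha)
    (by linear_combination -hb) (by linear_combination -hc) (by linear_combination -hd)
    (by linear_combination -he)

/-! ### Degree, walks and diameter of a circulant graph -/

namespace IsCanonicalGeneratingSet

variable {n : ℕ} {g : Fin 5 → ℕ}

/-- The sum of two generators lies strictly between 0 and `n`. This separates generators from
negatives of generators. -/
theorem natCast_add_ne_zero (hg : IsCanonicalGeneratingSet n g) (i j : Fin 5) :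
    (g i : ZMod n) + g j ≠ 0 := by
  rw [← Nat.cast_add, Ne, ZMod.natCast_eq_zero_iff]
  intro h
  have := Nat.le_of_dvd (by have := (hg.2 i).1; omega) h
  have := hg.2 i
  have := hg.2 j
  omega

theorem natCast_ne_zero (hg : IsCanonicalGeneratingSet n g) (i : Fin 5) : (g i : ZMod n) ≠ 0 :=
  fun h => hg.natCast_add_ne_zero i i (by rw [h, add_zero])

theorem natCast_injective (hg : IsCanonicalGeneratingSet n g) :
    Function.Injective fun i => (g i : ZMod n) := by
  intro i j h
  have hi := hg.2 i
  have hj := hg.2 j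
  refine hg.1 ?_
  have := (ZMod.natCast_eq_natCast_iff' _ _ _).1 h
  rwa [Nat.mod_eq_of_lt (by omega), Nat.mod_eq_of_lt (by omega)] at this

theorem adj_iff (hg : IsCanonicalGeneratingSet n g) {u v : ZMod n} :
    (circulantOn n g).Adj u v ↔ ∃ i, v = u + g i ∨ v = u - g i := by
  rw [circulantOn, SimpleGraph.circulantGraph_adj]
  constructor
  · rintro ⟨-, ⟨i, hi⟩ | ⟨i, hi⟩⟩ <;> simp only at hi
    · exact ⟨i, Or.inr (by rw [hi]; ring)⟩
    · exact ⟨i, Or.inl (by rw [hi]; ring)⟩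
  · rintro ⟨i, rfl | rfl⟩
    · exact ⟨by simpa using hg.natCast_ne_zero i, Or.inr ⟨i, by simp⟩⟩
    · exact ⟨by simpa [sub_eq_add_neg] using hg.natCast_ne_zero i, Or.inl ⟨i, by simp⟩⟩

theorem ncard_neighborSet (hg : IsCanonicalGeneratingSet n g) (v : ZMod n) :
    ((circulantOn n g).neighborSet v).ncard = 10 := by
  let f : Fin 5 × Bool → ZMod n := fun x => if x.2 then v + g x.1 else v - g x.1
  have hf : Function.Injective f := by
    rintro ⟨i, b⟩ ⟨j, c⟩ h
    cases b <;> cases c <;> simp only [f, if_true, Bool.false_eq_true, if_false] at h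
    · rw [hg.natCast_injective (sub_right_injective h)]
    · exact absurd (by linear_combination -h) (hg.natCast_add_ne_zero i j)
    · exact absurd (by linear_combination h) (hg.natCast_add_ne_zero i j)
    · rw [hg.natCast_injective (add_right_injective v h)]
  have hs : (circulantOn n g).neighborSet v = Set.range f := by
    ext u
    simp only [SimpleGraph.mem_neighborSet, hg.adj_iff, Set.mem_range, Prod.exists,
      Bool.exists_bool, f, if_true, Bool.false_eq_true, if_false]
    exact exists_congr fun i => by rw [or_comm, eq_comm, eq_comm (a := u)]
  rw [hs, ← Nat.card_coe_set_eq, Nat.card_range_of_injective hf]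
  simp

theorem exists_walk_of_mul (hg : IsCanonicalGeneratingSet n g) (i : Fin 5) (z : ℤ) (u : ZMod n) :
    ∃ w : (circulantOn n g).Walk u (u + z * g i), (w.length : ℤ) = |z| := by
  have nat : ∀ (l : ℕ) (u : ZMod n),
      (∃ w : (circulantOn n g).Walk u (u + l * g i), w.length = l) ∧
        ∃ w : (circulantOn n g).Walk u (u - l * g i), w.length = l := by
    intro l
    induction l with
    | zero => exact fun u => ⟨⟨SimpleGraph.Walk.nil.copy rfl (by simp), by simp⟩,
        ⟨SimpleGraph.Walk.nil.copy rfl (by simp), by simp⟩⟩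
    | succ l ih =>
      intro u
      obtain ⟨w, hw⟩ := (ih (u + g i)).1
      obtain ⟨w', hw'⟩ := (ih (u - g i)).2
      have h : (circulantOn n g).Adj u (u + g i) := hg.adj_iff.2 ⟨i, Or.inl rfl⟩
      have h' : (circulantOn n g).Adj u (u - g i) := hg.adj_iff.2 ⟨i, Or.inr rfl⟩
      exact ⟨⟨(w.cons h).copy rfl (by push_cast; ring), by simp [hw]⟩,
        ⟨(w'.cons h').copy rfl (by push_cast; ring), by simp [hw']⟩⟩
  obtain ⟨l, rfl | rfl⟩ := z.eq_nat_or_neg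
  · obtain ⟨w, hw⟩ := (nat l u).1
    exact ⟨w.copy rfl (by simp), by simp [hw]⟩
  · obtain ⟨w, hw⟩ := (nat l u).2
    exact ⟨w.copy rfl (by push_cast; ring), by simp [hw]⟩

theorem exists_walk_length_eq (hg : IsCanonicalGeneratingSet n g) (y : Fin 5 → ℤ) (u v : ZMod n)
    (h : v = u + ∑ i, y i * (g i : ZMod n)) :
    ∃ w : (circulantOn n g).Walk u v, (w.length : ℤ) = ∑ i, |y i| := by
  obtain ⟨w₀, h₀⟩ := hg.exists_walk_of_mul 0 (y 0) u
  obtain ⟨w₁, h₁⟩ := hg.exists_walk_of_mul 1 (y 1) (u + y 0 * g 0)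
  obtain ⟨w₂, h₂⟩ := hg.exists_walk_of_mul 2 (y 2) (u + y 0 * g 0 + y 1 * g 1)
  obtain ⟨w₃, h₃⟩ := hg.exists_walk_of_mul 3 (y 3) (u + y 0 * g 0 + y 1 * g 1 + y 2 * g 2)
  obtain ⟨w₄, h₄⟩ := hg.exists_walk_of_mul 4 (y 4)
    (u + y 0 * g 0 + y 1 * g 1 + y 2 * g 2 + y 3 * g 3)
  refine ⟨((((w₀.append w₁).append w₂).append w₃).append w₄).copy rfl ?_, ?_⟩
  · rw [h, Fin.sum_univ_five]; ring
  · simp [Fin.sum_univ_five, h₀, h₁, h₂, h₃, h₄]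

theorem exists_sum_of_walk (hg : IsCanonicalGeneratingSet n g) {u v : ZMod n}
    (w : (circulantOn n g).Walk u v) :
    ∃ y : Fin 5 → ℤ, v = u + ∑ i, y i * (g i : ZMod n) ∧ ∑ i, |y i| ≤ w.length := by
  induction w with
  | nil => exact ⟨0, by simp, by simp⟩
  | @cons u u' v h w ih =>
    obtain ⟨y, hy, hle⟩ := ih
    obtain ⟨i, s, hs, hu⟩ : ∃ (i : Fin 5) (s : ℤ), |s| ≤ 1 ∧ u' = u + s * g i := by
      obtain ⟨i, rfl | rfl⟩ := hg.adj_iff.1 h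
      · exact ⟨i, 1, by simp, by simp⟩
      · exact ⟨i, -1, by simp, by push_cast; ring⟩
    refine ⟨y + Pi.single i s, ?_, ?_⟩
    · have : ∑ j, ((Pi.single i s : Fin 5 → ℤ) j : ZMod n) * g j = s * g i := by
        rw [Finset.sum_eq_single i (fun j _ hj => by
            rw [Pi.single_eq_of_ne hj, Int.cast_zero, zero_mul]) (by simp), Pi.single_eq_same]
      simp only [Pi.add_apply, Int.cast_add, add_mul, Finset.sum_add_distrib, this]
      rw [hy, hu]; ring
    · have : ∑ j, |(Pi.single i s : Fin 5 → ℤ) j| = |s| := by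
        rw [Finset.sum_eq_single i (fun j _ hj => by
            rw [Pi.single_eq_of_ne hj, abs_zero]) (by simp), Pi.single_eq_same]
      have hle' : ∑ j, |(y + Pi.single i s : Fin 5 → ℤ) j| ≤
          ∑ j, (|y j| + |(Pi.single i s : Fin 5 → ℤ) j|) := Finset.sum_le_sum fun j _ => by
        rw [Pi.add_apply]; exact abs_add_le (y j) _
      rw [Finset.sum_add_distrib, this] at hle'
      rw [SimpleGraph.Walk.length_cons]
      push_cast
      linarith

/-- The diameter of a circulant graph is determined by the shortest representations of the
residues as combinations of generators. -/
theorem connected_and_diam_eq (hg : IsCanonicalGeneratingSet n g) {k : ℕ}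
    (h : ∀ z : ZMod n, ∃ y : Fin 5 → ℤ, z = ∑ i, y i * (g i : ZMod n) ∧ ∑ i, |y i| ≤ k)
    (z : ZMod n) (hz : ∀ y : Fin 5 → ℤ, z = ∑ i, y i * (g i : ZMod n) → k ≤ ∑ i, |y i|) :
    (circulantOn n g).Connected ∧ (circulantOn n g).diam = k := by
  have : NeZero n := ⟨by have := hg.2 0; omega⟩
  have hw : ∀ u v, ∃ w : (circulantOn n g).Walk u v, w.length ≤ k := fun u v => by
    obtain ⟨y, hy, hle⟩ := h (v - u)
    obtain ⟨w, hw⟩ := hg.exists_walk_length_eq y u v (by rw [← hy]; ring)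
    exact ⟨w, by exact_mod_cast hw.trans_le hle⟩
  have hc : (circulantOn n g).Connected := ⟨fun u v => ⟨(hw u v).choose⟩⟩
  refine ⟨hc, le_antisymm ?_ ?_⟩
  · obtain ⟨u, v, huv⟩ := (circulantOn n g).exists_dist_eq_diam
    obtain ⟨w, hw⟩ := hw u v
    exact huv ▸ (SimpleGraph.dist_le w).trans hw
  · obtain ⟨w, hw⟩ := hc.exists_walk_length_eq_dist 0 z
    obtain ⟨y, hy, hle⟩ := hg.exists_sum_of_walk w
    have := hz y (by rw [hy, zero_add])
    have hd := SimpleGraph.dist_le_diam (SimpleGraph.connected_iff_ediam_ne_top.1 hc)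
      (u := 0) (v := z)
    omega

end IsCanonicalGeneratingSet

/-! ### The family in the parameter `m`, where `k = 15m + 7` -/

def circulantOrder (m : ℕ) : ℕ :=
  124416 * m ^ 5 + 311040 * m ^ 4 + 316224 * m ^ 3 + 163296 * m ^ 2 + 42798 * m + 4551

def circulantGens (m : ℕ) : Fin 5 → ℕ :=
  ![1, 10368 * m ^ 4 + 20736 * m ^ 3 + 15912 * m ^ 2 + 5544 * m + 739,
    41472 * m ^ 5 + 100224 * m ^ 4 + 97920 * m ^ 3 + 48216 * m ^ 2 + 11922 * m + 1178,
    41472 * m ^ 5 + 100224 * m ^ 4 + 98784 * m ^ 3 + 49512 * m ^ 2 + 12588 * m + 1295,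
    41472 * m ^ 5 + 100224 * m ^ 4 + 98784 * m ^ 3 + 49512 * m ^ 2 + 12600 * m + 1301]

theorem isCanonicalGeneratingSet_circulantGens (m : ℕ) :
    IsCanonicalGeneratingSet (circulantOrder m) (circulantGens m) := by
  constructor
  · intro i j h
    fin_cases i <;> fin_cases j <;> simp [circulantGens] at h ⊢ <;> omega
  · intro i
    fin_cases i <;> simp [circulantGens, circulantOrder] <;> omega

theorem orderPoly_eq (m : ℕ) : orderPoly (2 * m + 1) = circulantOrder m := by
  simp only [orderPoly, circulantOrder]; push_cast; ring

theorem weight_eq (m : ℕ) (y : Fin 5 → ℤ) :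
    weight (2 * m + 1) (y 0) (y 1) (y 2) (y 3) (y 4) = ∑ i, y i * (circulantGens m i : ℤ) := by
  simp only [weight, genPoly₁, genPoly₂, genPoly₃, genPoly₄, circulantGens, Fin.sum_univ_five,
    Matrix.cons_val]
  push_cast
  ring

theorem theorem6 (k : ℕ) (hk : k ≡ 7 [MOD 15]) :
    ∃ (n : ℕ) (g : Fin 5 → ℕ),
      (n : ℚ) = (512 * (k : ℚ) ^ 5 + 1280 * (k : ℚ) ^ 4 + 6080 * (k : ℚ) ^ 3
        + 7840 * (k : ℚ) ^ 2 + 10010 * (k : ℚ) + 3741) / 3125 ∧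
      (g 0 : ℚ) = 1 ∧
      (g 1 : ℚ) = (128 * (k : ℚ) ^ 4 + 256 * (k : ℚ) ^ 3 + 1192 * (k : ℚ) ^ 2
        + 1064 * (k : ℚ) + 883) / 625 ∧
      (g 2 : ℚ) = (512 * (k : ℚ) ^ 5 + 640 * (k : ℚ) ^ 4 + 3200 * (k : ℚ) ^ 3
        - 2520 * (k : ℚ) ^ 2 - 8510 * (k : ℚ) - 12624) / 9375 ∧
      (g 3 : ℚ) = (512 * (k : ℚ) ^ 5 + 640 * (k : ℚ) ^ 4 + 5600 * (k : ℚ) ^ 3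
        + 1080 * (k : ℚ) ^ 2 + 4540 * (k : ℚ) - 6699) / 9375 ∧
      (g 4 : ℚ) = (512 * (k : ℚ) ^ 5 + 640 * (k : ℚ) ^ 4 + 5600 * (k : ℚ) ^ 3
        + 1080 * (k : ℚ) ^ 2 + 12040 * (k : ℚ) - 2949) / 9375 ∧
      IsCanonicalGeneratingSet n g ∧
      Nat.card (ZMod n) = n ∧
      (∀ v : ZMod n, ((circulantOn n g).neighborSet v).ncard = 10) ∧
      (circulantOn n g).Connected ∧
      (circulantOn n g).diam = k := by
  obtain ⟨m, rfl⟩ : ∃ m, k = 15 * m + 7 := ⟨k / 15, by unfold Nat.ModEq at hk; omega⟩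
  have hg := isCanonicalGeneratingSet_circulantGens m
  refine ⟨circulantOrder m, circulantGens m, ?_, ?_, ?_, ?_, ?_, ?_, hg, Nat.card_zmod _,
    hg.ncard_neighborSet, ?_⟩
  · simp only [circulantOrder]; push_cast; ring
  · simp [circulantGens]
  iterate 4 simp only [circulantGens, Matrix.cons_val]; push_cast; ring
  have : NeZero (circulantOrder m) := ⟨by unfold circulantOrder; omega⟩
  have cast_eq : ∀ (z : ℤ) (y : Fin 5 → ℤ),
      (z : ZMod (circulantOrder m)) = ∑ i, y i * (circulantGens m i : ZMod (circulantOrder m)) ↔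
        orderPoly (2 * m + 1) ∣ z - weight (2 * m + 1) (y 0) (y 1) (y 2) (y 3) (y 4) := by
    intro z y
    rw [orderPoly_eq, weight_eq, ← ZMod.intCast_eq_intCast_iff_dvd_sub, eq_comm]
    push_cast
    rfl
  -- The vertex at distance `k` from 0 is the weight of the deep point from the lower bound.
  refine hg.connected_and_diam_eq (fun z => ?_)
    ((weight (2 * m + 1) (3 * m + 2) (3 * m + 1) (3 * m + 1) (3 * m + 2) (3 * m + 1) : ℤ) :
      ZMod (circulantOrder m)) fun y hy => ?_
  · obtain ⟨a, b, c, d, e, h, hz⟩ := exists_short (t := 2 * m + 1) (k := (15 * m + 7 : ℕ))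
      (by omega) (by push_cast; ring) z.val
    refine ⟨![a, b, c, d, e], ?_, by simpa [Fin.sum_univ_five] using h⟩
    have := (cast_eq z.val ![a, b, c, d, e]).2 hz
    rwa [Int.cast_natCast, ZMod.natCast_zmod_val] at this
  · have := lt_norm_of_dvd_weight_sub (Int.natCast_nonneg m) ((cast_eq _ y).1 hy)
    rw [Fin.sum_univ_five]
    push_cast
    omega
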